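/- Let $F$ be a complex Banach space (for instance a complexified Banach space of functions), let $(E_t)_{t\ge 0}$ be a strongly continuous semigroup of bounded linear operators on $F$, and let $B$ be its generator: $\mathcal D(B)$ is the set of $f\in F$ for which $Bf:=\lim_{t\to 0^+}(E_tf-f)/t$ exists in $F$. Let $\sigma(B)$ be the set of $\xi\in\mathbb C$ for which $\xi I-B:\mathcal D(B)\to F$ is not a bijection, and let $R(\xi)=(\xi I-B)^{-1}$ for $\xi\notin\sigma(B)$. For $0<\delta<\pi/2$ put $\bar\sigma_\delta=\{\xi\in\mathbb C\setminus\{0\}:|\arg\xi|>\pi/2+\delta\}$. **(1)** The following are equivalent. (a) The orbits of the semigroup are analytic for $t>0$ in the sense of bounded analytic semigroups: there is $\theta\in(0,\pi/2)$ such that for every $f\in F$ the map $t\mapsto E_tf$, $t>0$, extends to a bounded holomorphic function on the sector $\{z\ne 0:|\arg z|<\theta\}$ with values in $F$. (b) There are $0<\delta<\pi/2$ and $C_B<\infty$ such that $$\sigma(B)\subseteq\bar\sigma_\delta\cup\{0\}\qquad\text{and}\qquad \|R(\xi)\|_{\mathrm{op}}\le\frac{C_B}{|\xi|}\quad\text{for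 all }\xi\in\mathbb C\setminus(\bar\sigma_\delta\cup\{0\}).$$ **(2)** Suppose that (b) holds with constants $\delta$ and $C_B$. Then $t\mapsto E_tf$ is real analytic at every $t>0$, for every $f\in F$. Moreover, if $f=E_{\tau_0}g$ for some $\tau_0>0$ and $g\in F$, then $f\in\bigcap_{m\ge 1}\mathcal D(B^m)$ and, with $u_t=E_tf$ and $\hat u_t=\sum_{m=0}^M\frac{t^m}{m!}B^mf$, $$\|u_t-\hat u_t\|_F\to 0\quad\text{as }M\to\infty,\qquad\text{for all } 0\le t<\frac{\tau_0}{C_B\,e}.$$ -/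

import Mathlib

open Filter Topology

/-- A strongly continuous semigroup `(E t)`, `t ≥ 0`, of bounded linear operators on `F`.
Only the values at `t ≥ 0` are meaningful. -/
structure IsC0Semigroup {F : Type*} [NormedAddCommGroup F] [NormedSpace ℂ F]
    (E : ℝ → F →L[ℂ] F) : Prop where
  map_zero : E 0 = ContinuousLinearMap.id ℂ F
  map_add : ∀ s t : ℝ, 0 ≤ s → 0 ≤ t → E (s + t) = (E s).comp (E t)
  continuous_zero : ∀ f : F, Tendsto (fun t : ℝ => E t f) (𝓝[>] 0) (𝓝 f)

/-- `g` is the limit in norm of `(E t f - f) / t` as `t → 0+`. -/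
def HasGenerator {F : Type*} [NormedAddCommGroup F] [NormedSpace ℂ F]
    (E : ℝ → F →L[ℂ] F) (f g : F) : Prop :=
  Tendsto (fun t : ℝ => (t : ℂ)⁻¹ • (E t f - f)) (𝓝[>] 0) (𝓝 g)

theorem HasGenerator.unique {F : Type*} [NormedAddCommGroup F] [NormedSpace ℂ F]
    {E : ℝ → F →L[ℂ] F} {f g h : F} (hg : HasGenerator E f g) (hh : HasGenerator E f h) :
    g = h :=
  tendsto_nhds_unique hg hh

theorem HasGenerator.zero {F : Type*} [NormedAddCommGroup F] [NormedSpace ℂ F]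
    (E : ℝ → F →L[ℂ] F) : HasGenerator E 0 0 := by
  simp [HasGenerator]

theorem HasGenerator.add {F : Type*} [NormedAddCommGroup F] [NormedSpace ℂ F]
    {E : ℝ → F →L[ℂ] F} {f₁ f₂ g₁ g₂ : F} (h₁ : HasGenerator E f₁ g₁)
    (h₂ : HasGenerator E f₂ g₂) : HasGenerator E (f₁ + f₂) (g₁ + g₂) := by
  refine (Tendsto.add h₁ h₂).congr fun t => ?_
  rw [← smul_add, map_add]
  congr 1
  abel

theorem HasGenerator.smul {F : Type*} [NormedAddCommGroup F] [NormedSpace ℂ F]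
    {E : ℝ → F →L[ℂ] F} {f g : F} (c : ℂ) (h : HasGenerator E f g) :
    HasGenerator E (c • f) (c • g) := by
  refine (Tendsto.const_smul h c).congr fun t => ?_
  rw [smul_comm, smul_sub, map_smul]

/-- The generator `B` of `E`: its domain is the set of `f` for which `(E t f - f) / t` converges
in norm as `t → 0+`, and `B f` is the limit. -/
noncomputable def generator {F : Type*} [NormedAddCommGroup F] [NormedSpace ℂ F]
    (E : ℝ → F →L[ℂ] F) : F →ₗ.[ℂ] F where
  domain :=
    { carrier := {f | ∃ g, HasGenerator E f g}
      zero_mem' := ⟨0, HasGenerator.zero E⟩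
      add_mem' := fun ⟨_, h₁⟩ ⟨_, h₂⟩ => ⟨_, h₁.add h₂⟩
      smul_mem' := fun c _ ⟨_, h⟩ => ⟨_, h.smul c⟩ }
  toFun :=
    { toFun := fun f => f.2.choose
      map_add' := fun f₁ f₂ =>
        (f₁ + f₂).2.choose_spec.unique (f₁.2.choose_spec.add f₂.2.choose_spec)
      map_smul' := fun c f => (c • f).2.choose_spec.unique (f.2.choose_spec.smul c) }

/-- The operator `ξ I - B` on the domain of `B`. -/
def shifted {F : Type*} [NormedAddCommGroup F] [NormedSpace ℂ F]
    (B : F →ₗ.[ℂ] F) (ξ : ℂ) : B.domain →ₗ[ℂ] F :=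
  ξ • B.domain.subtype - B.toFun

/-- The spectrum `σ(B)`: the set of `ξ` for which `ξ I - B : D(B) → F` is not a bijection. -/
def opSpectrum {F : Type*} [NormedAddCommGroup F] [NormedSpace ℂ F]
    (B : F →ₗ.[ℂ] F) : Set ℂ :=
  {ξ | ¬ Function.Bijective (shifted B ξ)}

/-- The resolvent `R(ξ) = (ξ I - B)⁻¹ : F → D(B) ⊆ F` for `ξ ∉ σ(B)`. -/
noncomputable def opResolvent {F : Type*} [NormedAddCommGroup F] [NormedSpace ℂ F]
    (B : F →ₗ.[ℂ] F) (ξ : ℂ) (hξ : ξ ∉ opSpectrum B) : F →ₗ[ℂ] F :=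
  B.domain.subtype ∘ₗ
    (LinearEquiv.ofBijective (shifted B ξ) (not_not.mp hξ)).symm.toLinearMap

/-- The open sector `{z ≠ 0 : |arg z| < θ}` around the positive half-line. -/
def posSector (θ : ℝ) : Set ℂ := {z | z ≠ 0 ∧ |z.arg| < θ}

/-- The sector `{ξ ≠ 0 : |arg ξ| > π/2 + δ}` around the negative half-line. -/
def negSector (δ : ℝ) : Set ℂ := {ξ | ξ ≠ 0 ∧ Real.pi / 2 + δ < |ξ.arg|}

/-- The orbits of `E` are (boundedly) analytic for `t > 0`: there is a sector around `(0, ∞)` to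
which every orbit `t ↦ E t f`, `t > 0`, extends as a bounded holomorphic function. -/
def HasAnalyticOrbits {F : Type*} [NormedAddCommGroup F] [NormedSpace ℂ F]
    (E : ℝ → F →L[ℂ] F) : Prop :=
  ∃ θ : ℝ, 0 < θ ∧ θ < Real.pi / 2 ∧ ∀ f : F, ∃ U : ℂ → F,
    DifferentiableOn ℂ U (posSector θ) ∧
    (∀ t : ℝ, 0 < t → U t = E t f) ∧
    ∃ K : ℝ, ∀ z ∈ posSector θ, ‖U z‖ ≤ K

/-- The spectrum of `B` lies in `{|arg ξ| > π/2 + δ}`, up to the point `0`, which has no argument,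
and `‖R(ξ)‖ ≤ C / |ξ|` in operator norm at all `ξ ≠ 0` outside this sector. -/
def SectorialBound {F : Type*} [NormedAddCommGroup F] [NormedSpace ℂ F]
    (B : F →ₗ.[ℂ] F) (δ C : ℝ) : Prop :=
  opSpectrum B ⊆ negSector δ ∪ {0} ∧
  ∀ (ξ : ℂ) (hξ : ξ ∉ opSpectrum B), ξ ≠ 0 → ξ ∉ negSector δ →
    ∀ g : F, ‖opResolvent B ξ hξ g‖ ≤ C / ‖ξ‖ * ‖g‖

/-- `B` as a function on all of `F`, with the value `0` outside the domain. -/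
noncomputable def extendZero {F : Type*} [NormedAddCommGroup F] [NormedSpace ℂ F]
    (B : F →ₗ.[ℂ] F) (f : F) : F :=
  open Classical in if h : f ∈ B.domain then B ⟨f, h⟩ else 0

/-- `B ^ m f`; meaningful for `f ∈ D(B ^ m)`. -/
noncomputable def genPow {F : Type*} [NormedAddCommGroup F] [NormedSpace ℂ F]
    (B : F →ₗ.[ℂ] F) (m : ℕ) (f : F) : F :=
  (extendZero B)^[m] f

/-- The domain `D(B^∞)`, the intersection of all `D(B ^ m)`: `f, B f, B ^ 2 f, …` all lie in
`D(B)`. -/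
def domInfty {F : Type*} [NormedAddCommGroup F] [NormedSpace ℂ F]
    (B : F →ₗ.[ℂ] F) : Set F :=
  {f | ∀ m : ℕ, genPow B m f ∈ B.domain}

/-- The Taylor polynomial `∑_{m ≤ M} t ^ m / m! • B ^ m f`. -/
noncomputable def taylorSum {F : Type*} [NormedAddCommGroup F] [NormedSpace ℂ F]
    (B : F →ₗ.[ℂ] F) (f : F) (M : ℕ) (t : ℝ) : F :=
  ∑ m ∈ Finset.range (M + 1), ((t ^ m / (m.factorial : ℝ) : ℝ) : ℂ) • genPow B m f

section

open MeasureTheory Set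

namespace IsC0Semigroup

variable {F : Type*} [NormedAddCommGroup F] [NormedSpace ℂ F] {E : ℝ → F →L[ℂ] F}

theorem apply_zero (hE : IsC0Semigroup E) (f : F) : E 0 f = f := by
  simp [hE.map_zero]

theorem apply_add (hE : IsC0Semigroup E) {s t : ℝ} (hs : 0 ≤ s) (ht : 0 ≤ t) (f : F) :
    E (s + t) f = E s (E t f) := by
  rw [hE.map_add s t hs ht]; rfl

theorem apply_comm (hE : IsC0Semigroup E) {s t : ℝ} (hs : 0 ≤ s) (ht : 0 ≤ t) (f : F) :
    E s (E t f) = E t (E s f) := by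
  rw [← hE.apply_add hs ht, add_comm, hE.apply_add ht hs]

/-- A strongly continuous semigroup is uniformly bounded near `0`. -/
theorem exists_bound_near_zero [CompleteSpace F] (hE : IsC0Semigroup E) :
    ∃ δ M : ℝ, 0 < δ ∧ ∀ t ∈ Icc 0 δ, ‖E t‖ ≤ M := by
  by_contra! h
  have h' : ∀ n : ℕ, ∃ t ∈ Icc (0 : ℝ) (1 / ((n : ℝ) + 1)), (n : ℝ) + ‖E 0‖ < ‖E t‖ := fun n =>
    h _ _ Nat.one_div_pos_of_nat
  choose t ht hn using h'
  have hpos : ∀ n, 0 < t n := by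
    intro n
    refine lt_of_le_of_ne (ht n).1 fun h0 => ?_
    have := hn n
    rw [← h0] at this
    linarith [(Nat.cast_nonneg n : (0 : ℝ) ≤ n)]
  have htend : Tendsto t atTop (𝓝[>] 0) := by
    refine tendsto_nhdsWithin_iff.2 ⟨?_, Eventually.of_forall hpos⟩
    exact squeeze_zero (fun n => (ht n).1) (fun n => (ht n).2)
      tendsto_one_div_add_atTop_nhds_zero_nat
  obtain ⟨C, hC⟩ := banach_steinhaus (g := fun n => E (t n)) (fun f => by
    obtain ⟨C, hC⟩ := (((hE.continuous_zero f).comp htend).norm).bddAbove_range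
    exact ⟨C, fun n => hC ⟨n, rfl⟩⟩)
  obtain ⟨n, hn'⟩ := exists_nat_gt C
  linarith [hC n, hn n, norm_nonneg (E 0)]

theorem norm_pow_le (hE : IsC0Semigroup E) {T a : ℝ} (hT : 0 ≤ T) (h : ‖E T‖ ≤ Real.exp a)
    (n : ℕ) : ‖E (n * T)‖ ≤ Real.exp (n * a) := by
  induction n with
  | zero =>
    simp only [Nat.cast_zero, zero_mul, hE.map_zero, Real.exp_zero]
    exact ContinuousLinearMap.norm_id_le
  | succ n ih =>
    have : ((n + 1 : ℕ) : ℝ) * T = T + n * T := by push_cast; ring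
    rw [this, hE.map_add _ _ hT (by positivity)]
    refine (ContinuousLinearMap.opNorm_comp_le _ _).trans ?_
    refine (mul_le_mul h ih (norm_nonneg _) (Real.exp_nonneg _)).trans_eq ?_
    rw [← Real.exp_add]
    congr 1
    push_cast; ring

/-- A bound at a single time gives an exponential bound at all times. -/
theorem exists_bound_of_norm_le_exp (hE : IsC0Semigroup E) {T a M : ℝ} (hT : 0 < T)
    (hM : ∀ t ∈ Icc 0 T, ‖E t‖ ≤ M) (h : ‖E T‖ ≤ Real.exp (a * T)) :
    ∃ M' : ℝ, ∀ t : ℝ, 0 ≤ t → ‖E t‖ ≤ M' * Real.exp (a * t) := by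
  have hM0 : 0 ≤ M := (norm_nonneg _).trans (hM 0 ⟨le_rfl, hT.le⟩)
  refine ⟨M * Real.exp (|a| * T), fun t ht => ?_⟩
  set n := ⌊t / T⌋₊
  have h1 : (n : ℝ) * T ≤ t := by
    have := Nat.floor_le (div_nonneg ht hT.le)
    rwa [le_div_iff₀ hT] at this
  have h2 : t < (n + 1) * T := by
    have := Nat.lt_floor_add_one (t / T)
    rwa [div_lt_iff₀ hT] at this
  have h3 : E t = (E (n * T)).comp (E (t - n * T)) := by
    rw [← hE.map_add _ _ (by positivity) (by linarith)]
    congr 1; ring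
  rw [h3]
  refine (ContinuousLinearMap.opNorm_comp_le _ _).trans ?_
  refine (mul_le_mul (hE.norm_pow_le hT.le h n) (hM (t - n * T) ⟨by linarith, by linarith⟩)
    (norm_nonneg _) (Real.exp_nonneg _)).trans ?_
  rw [mul_comm, mul_assoc, ← Real.exp_add]
  refine mul_le_mul_of_nonneg_left (Real.exp_le_exp.2 ?_) hM0
  have h4 : -(a * (t - n * T)) ≤ |a| * T := by
    calc -(a * (t - n * T)) ≤ |a * (t - n * T)| := neg_le_abs _
      _ = |a| * (t - n * T) := by rw [abs_mul, abs_of_nonneg (by linarith : 0 ≤ t - n * T)]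
      _ ≤ |a| * T := mul_le_mul_of_nonneg_left (by linarith) (abs_nonneg _)
  linarith

theorem exists_exp_bound [CompleteSpace F] (hE : IsC0Semigroup E) :
    ∃ ω M : ℝ, 0 < ω ∧ ∀ t : ℝ, 0 ≤ t → ‖E t‖ ≤ M * Real.exp (ω * t) := by
  obtain ⟨δ, M, hδ, hM⟩ := hE.exists_bound_near_zero
  refine ⟨(|M| + 1) / δ, ?_⟩
  obtain ⟨M', h⟩ := hE.exists_bound_of_norm_le_exp (a := (|M| + 1) / δ) hδ hM (by
    rw [div_mul_cancel₀ _ hδ.ne']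
    refine (hM δ ⟨hδ.le, le_rfl⟩).trans ((le_abs_self M).trans ?_)
    have := Real.add_one_le_exp (|M| + 1)
    linarith)
  exact ⟨M', by positivity, h⟩

theorem exists_bound_Icc [CompleteSpace F] (hE : IsC0Semigroup E) (T : ℝ) :
    ∃ M : ℝ, ∀ t ∈ Icc 0 T, ‖E t‖ ≤ M := by
  obtain ⟨ω, M, hω, h⟩ := hE.exists_exp_bound
  refine ⟨M * Real.exp (ω * T), fun t ht => (h t ht.1).trans ?_⟩
  have hM0 : 0 ≤ M := by
    have := (norm_nonneg _).trans (h 0 le_rfl)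
    simpa using this
  gcongr
  exact ht.2

/-- Strong continuity on `[0, ∞)`. -/
theorem continuousOn [CompleteSpace F] (hE : IsC0Semigroup E) (f : F) :
    ContinuousOn (fun t => E t f) (Ici 0) := by
  have h0 : Tendsto (fun t => E t f) (𝓝[≥] 0) (𝓝 f) := by
    rw [← Ioi_insert, nhdsWithin_insert, tendsto_sup]
    refine ⟨?_, hE.continuous_zero f⟩
    rw [tendsto_pure_left]
    intro s hs
    rw [hE.apply_zero]; exact mem_of_mem_nhds hs
  intro t ht
  obtain ⟨M, hM⟩ := hE.exists_bound_Icc (t + 1)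
  have hM0 : 0 ≤ M := (norm_nonneg _).trans (hM t ⟨ht, by linarith⟩)
  have key : ∀ s ∈ Icc 0 (t + 1), ‖E s f - E t f‖ ≤ M * ‖E |s - t| f - f‖ := by
    intro s hs
    rcases le_total t s with h | h
    · rw [abs_of_nonneg (by linarith)]
      have : E s f = E t (E (s - t) f) := by
        rw [← hE.apply_add ht (by linarith)]; congr 2; ring
      rw [this, ← map_sub]
      exact (E t).le_of_opNorm_le (hM t ⟨ht, by linarith⟩) _
    · rw [abs_of_nonpos (by linarith), norm_sub_rev]
      have : E t f = E s (E (-(s - t)) f) := by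
        rw [← hE.apply_add hs.1 (by linarith)]; congr 2; ring
      rw [this, ← map_sub]
      exact (E s).le_of_opNorm_le (hM s hs) _
  rw [ContinuousWithinAt, tendsto_iff_norm_sub_tendsto_zero]
  have hlim : Tendsto (fun s : ℝ => M * ‖E |s - t| f - f‖) (𝓝[Ici 0] t) (𝓝 0) := by
    have h1 : Tendsto (fun s : ℝ => |s - t|) (𝓝[Ici 0] t) (𝓝[≥] 0) := by
      refine tendsto_nhdsWithin_iff.2 ⟨?_, Eventually.of_forall fun s => mem_Ici.2 (abs_nonneg _)⟩
      have : Continuous fun s : ℝ => |s - t| := by fun_prop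
      simpa using (this.tendsto t).mono_left (nhdsWithin_le_nhds (s := Ici 0))
    have := ((tendsto_iff_norm_sub_tendsto_zero.1 (h0.comp h1)).const_mul M)
    rwa [mul_zero] at this
  refine squeeze_zero' (Eventually.of_forall fun s => norm_nonneg _) ?_ hlim
  have : Iio (t + 1) ∈ 𝓝[Ici 0] t := mem_nhdsWithin_of_mem_nhds (Iio_mem_nhds (by linarith))
  filter_upwards [self_mem_nhdsWithin, this] with s h1 h2
  exact key s ⟨h1, h2.le⟩

theorem continuous_max [CompleteSpace F] (hE : IsC0Semigroup E) (f : F) :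
    Continuous (fun t => E (max t 0) f) :=
  (hE.continuousOn f).comp_continuous (by fun_prop) fun t => mem_Ici.2 (le_max_right _ _)

theorem hasGenerator_apply (hE : IsC0Semigroup E) {f g : F} (h : HasGenerator E f g) {t : ℝ}
    (ht : 0 ≤ t) : HasGenerator E (E t f) (E t g) := by
  refine (((E t).continuous.tendsto g).comp h).congr' ?_
  filter_upwards [self_mem_nhdsWithin] with s hs
  simp only [Function.comp, map_smul, map_sub]
  rw [hE.apply_comm ht (le_of_lt hs)]

theorem hasDerivWithinAt_right (hE : IsC0Semigroup E) {f g : F} (h : HasGenerator E f g) {t : ℝ}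
    (ht : 0 ≤ t) : HasDerivWithinAt (fun s => E s f) (E t g) (Ioi t) t := by
  rw [hasDerivWithinAt_iff_tendsto_slope' self_notMem_Ioi]
  have h1 : Tendsto (fun s : ℝ => s - t) (𝓝[>] t) (𝓝[>] 0) := by
    refine tendsto_nhdsWithin_iff.2 ⟨?_, ?_⟩
    · have : Continuous fun s : ℝ => s - t := by fun_prop
      simpa using (this.tendsto t).mono_left (nhdsWithin_le_nhds (s := Ioi t))
    · filter_upwards [self_mem_nhdsWithin] with s hs
      simpa using hs
  refine ((hE.hasGenerator_apply h ht).comp h1).congr' ?_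
  filter_upwards [self_mem_nhdsWithin] with s hs
  have hs' : 0 ≤ s - t := sub_nonneg.2 (le_of_lt hs)
  simp only [Function.comp, slope, vsub_eq_sub]
  rw [← hE.apply_add hs' ht, sub_add_cancel, ← Complex.ofReal_inv]
  exact Complex.coe_smul _ _

theorem intervalIntegrable [CompleteSpace F] (hE : IsC0Semigroup E) (f : F) {a b : ℝ} (ha : 0 ≤ a)
    (hb : 0 ≤ b) : IntervalIntegrable (fun s => E s f) volume a b :=
  ((hE.continuousOn f).mono fun _ hx => (le_min ha hb).trans hx.1).intervalIntegrable

theorem apply_sub_eq_integral [CompleteSpace F] (hE : IsC0Semigroup E) {f g : F}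
    (h : HasGenerator E f g) {t : ℝ} (ht : 0 ≤ t) : E t f - f = ∫ s in (0 : ℝ)..t, E s g := by
  rw [intervalIntegral.integral_eq_sub_of_hasDeriv_right (f := fun s => E s f), hE.apply_zero]
  · exact (hE.continuousOn f).mono (by rw [uIcc_of_le ht]; exact fun x hx => hx.1)
  · intro x hx
    rw [min_eq_left ht] at hx
    exact hE.hasDerivWithinAt_right h hx.1.le
  · exact hE.intervalIntegrable g le_rfl ht

theorem integral_hasDerivWithinAt_zero [CompleteSpace F] (hE : IsC0Semigroup E) (g : F) :
    Tendsto (fun t : ℝ => (t : ℂ)⁻¹ • ∫ s in (0 : ℝ)..t, E s g) (𝓝[>] 0) (𝓝 g) := by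
  have h : HasDerivAt (fun t => ∫ s in (0 : ℝ)..t, E (max s 0) g) (E (max 0 0) g) 0 :=
    intervalIntegral.integral_hasDerivAt_right
      ((hE.continuous_max g).intervalIntegrable _ _)
      ((hE.continuous_max g).stronglyMeasurableAtFilter _ _) (hE.continuous_max g).continuousAt
  have h2 := (hasDerivWithinAt_iff_tendsto_slope' self_notMem_Ioi).1
    (h.hasDerivWithinAt (s := Ioi 0))
  rw [max_self, hE.apply_zero] at h2
  refine h2.congr' ?_
  filter_upwards [self_mem_nhdsWithin] with t ht
  simp only [slope, vsub_eq_sub, intervalIntegral.integral_same, sub_zero]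
  rw [← Complex.ofReal_inv]
  refine Eq.trans ?_ (Complex.coe_smul _ _).symm
  congr 1
  refine intervalIntegral.integral_congr fun s hs => ?_
  rw [uIcc_of_le (le_of_lt ht)] at hs
  simp [max_eq_left hs.1]

theorem hasGenerator_iff [CompleteSpace F] (hE : IsC0Semigroup E) {f g : F} :
    HasGenerator E f g ↔ ∀ t : ℝ, 0 ≤ t → E t f - f = ∫ s in (0 : ℝ)..t, E s g := by
  refine ⟨fun h t ht => hE.apply_sub_eq_integral h ht, fun h => ?_⟩
  refine (hE.integral_hasDerivWithinAt_zero g).congr' ?_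
  filter_upwards [self_mem_nhdsWithin] with t ht
  rw [h t (le_of_lt ht)]

theorem hasDerivAt [CompleteSpace F] (hE : IsC0Semigroup E) {f g : F}
    (h : HasGenerator E f g) {t : ℝ} (ht : 0 < t) : HasDerivAt (fun s => E s f) (E t g) t := by
  have h1 : HasDerivAt (fun t => ∫ s in (0 : ℝ)..t, E (max s 0) g) (E (max t 0) g) t :=
    intervalIntegral.integral_hasDerivAt_right
      ((hE.continuous_max g).intervalIntegrable _ _)
      ((hE.continuous_max g).stronglyMeasurableAtFilter _ _) (hE.continuous_max g).continuousAt
  rw [max_eq_left ht.le] at h1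
  refine (h1.const_add f).congr_of_eventuallyEq ?_
  filter_upwards [Ioi_mem_nhds ht] with t ht
  rw [← sub_eq_iff_eq_add', hE.apply_sub_eq_integral h (le_of_lt ht)]
  refine intervalIntegral.integral_congr fun s hs => ?_
  rw [uIcc_of_le (le_of_lt ht)] at hs
  simp [max_eq_left hs.1]

/-- The generator is a closed operator. -/
theorem hasGenerator_of_tendsto [CompleteSpace F] (hE : IsC0Semigroup E) {ι : Type*}
    {l : Filter ι} [l.NeBot] {f g : ι → F} {f₀ g₀ : F} (h : ∀ᶠ i in l, HasGenerator E (f i) (g i))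
    (hf : Tendsto f l (𝓝 f₀)) (hg : Tendsto g l (𝓝 g₀)) : HasGenerator E f₀ g₀ := by
  rw [hE.hasGenerator_iff]
  intro t ht
  obtain ⟨M, hM⟩ := hE.exists_bound_Icc t
  have h1 : Tendsto (fun i => E t (f i) - f i) l (𝓝 (E t f₀ - f₀)) :=
    (((E t).continuous.tendsto _).comp hf).sub hf
  have h2 : Tendsto (fun i => ∫ s in (0 : ℝ)..t, E s (g i)) l (𝓝 (∫ s in (0 : ℝ)..t, E s g₀)) := by
    rw [tendsto_iff_norm_sub_tendsto_zero]
    have h3 : Tendsto (fun i => M * ‖g i - g₀‖ * |t - 0|) l (𝓝 0) := by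
      have := (((tendsto_iff_norm_sub_tendsto_zero.1 hg).const_mul M).mul_const |t - 0|)
      simpa using this
    refine squeeze_zero (fun _ => norm_nonneg _) (fun i => ?_) h3
    rw [← intervalIntegral.integral_sub (hE.intervalIntegrable _ le_rfl ht)
      (hE.intervalIntegrable _ le_rfl ht)]
    refine intervalIntegral.norm_integral_le_of_norm_le_const fun s hs => ?_
    rw [uIoc_of_le ht] at hs
    rw [← map_sub]
    exact (E s).le_of_opNorm_le (hM s ⟨hs.1.le, hs.2⟩) _
  refine tendsto_nhds_unique h1 (h2.congr' ?_)
  filter_upwards [h] with i hi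
  rw [hE.apply_sub_eq_integral hi ht]

theorem hasGenerator_integral [CompleteSpace F] (hE : IsC0Semigroup E) (f : F) {t : ℝ}
    (ht : 0 ≤ t) : HasGenerator E (∫ s in (0 : ℝ)..t, E s f) (E t f - f) := by
  have h1 := hE.integral_hasDerivWithinAt_zero f
  have h2 := hE.integral_hasDerivWithinAt_zero (E t f)
  refine (h2.sub h1).congr' ?_
  filter_upwards [self_mem_nhdsWithin] with h hh
  have hh' : 0 ≤ h := le_of_lt hh
  rw [← smul_sub]
  congr 1
  have e1 : E h (∫ s in (0 : ℝ)..t, E s f) = ∫ s in (0 : ℝ)..t, E (s + h) f := by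
    rw [← ContinuousLinearMap.intervalIntegral_comp_comm _ (hE.intervalIntegrable f le_rfl ht)]
    refine intervalIntegral.integral_congr fun s hs => ?_
    rw [uIcc_of_le ht] at hs
    change E h (E s f) = _
    rw [← hE.apply_add hh' hs.1, add_comm]
  have e2 : ∫ s in (0 : ℝ)..h, E s (E t f) = ∫ s in (0 : ℝ)..h, E (s + t) f := by
    refine intervalIntegral.integral_congr fun s hs => ?_
    rw [uIcc_of_le hh'] at hs
    rw [← hE.apply_add hs.1 ht]
  rw [e1, e2, intervalIntegral.integral_comp_add_right (fun s => E s f),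
    intervalIntegral.integral_comp_add_right (fun s => E s f), zero_add, zero_add]
  have i1 : ∀ a b : ℝ, 0 ≤ a → 0 ≤ b → IntervalIntegrable (fun s => E s f) volume a b :=
    fun a b ha hb => hE.intervalIntegrable f ha hb
  rw [add_comm h t,
    ← intervalIntegral.integral_add_adjacent_intervals (i1 h t hh' ht)
    (i1 t (t + h) ht (by linarith)),
    ← intervalIntegral.integral_add_adjacent_intervals (i1 0 h le_rfl hh') (i1 h t hh' ht)]
  abel

/-- The domain of the generator is dense. -/
theorem exists_seq_hasGenerator [CompleteSpace F] (hE : IsC0Semigroup E) (f : F) :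
    ∃ u v : ℕ → F, (∀ n, HasGenerator E (u n) (v n)) ∧ Tendsto u atTop (𝓝 f) := by
  have ht : Tendsto (fun n : ℕ => 1 / ((n : ℝ) + 1)) atTop (𝓝[>] 0) :=
    tendsto_nhdsWithin_iff.2 ⟨tendsto_one_div_add_atTop_nhds_zero_nat,
      Eventually.of_forall fun n => mem_Ioi.2 Nat.one_div_pos_of_nat⟩
  exact ⟨_, _, fun n => (hE.hasGenerator_integral f (Nat.one_div_pos_of_nat (n := n)).le).smul _,
    (hE.integral_hasDerivWithinAt_zero f).comp ht⟩

end IsC0Semigroup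

section Generator

variable {F : Type*} [NormedAddCommGroup F] [NormedSpace ℂ F] {E : ℝ → F →L[ℂ] F}

theorem hasGenerator_generator (f : (generator E).domain) :
    HasGenerator E (f : F) ((generator E) f) :=
  f.2.choose_spec

theorem generator_apply {f : (generator E).domain} {g : F} (h : HasGenerator E (f : F) g) :
    generator E f = g :=
  (hasGenerator_generator f).unique h

theorem HasGenerator.mem_domain {f g : F} (h : HasGenerator E f g) : f ∈ (generator E).domain :=
  ⟨g, h⟩

theorem HasGenerator.extendZero_eq {f g : F} (h : HasGenerator E f g) :
    extendZero (generator E) f = g := by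
  rw [extendZero, dif_pos h.mem_domain]
  exact generator_apply h

theorem shifted_apply (f : (generator E).domain) (ξ : ℂ) :
    shifted (generator E) ξ f = ξ • (f : F) - generator E f := rfl

theorem opResolvent_spec {ξ : ℂ} (hξ : ξ ∉ opSpectrum (generator E)) (g : F) :
    ∃ x : (generator E).domain, opResolvent (generator E) ξ hξ g = x ∧
      shifted (generator E) ξ x = g :=
  ⟨(LinearEquiv.ofBijective (shifted (generator E) ξ) (not_not.mp hξ)).symm g, rfl,
    (LinearEquiv.ofBijective (shifted (generator E) ξ) (not_not.mp hξ)).apply_symm_apply g⟩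

theorem hasGenerator_opResolvent {ξ : ℂ} (hξ : ξ ∉ opSpectrum (generator E)) (g : F) :
    HasGenerator E (opResolvent (generator E) ξ hξ g)
      (ξ • opResolvent (generator E) ξ hξ g - g) := by
  obtain ⟨x, h1, h2⟩ := opResolvent_spec hξ g
  rw [h1, ← h2, shifted_apply, sub_sub_cancel]
  exact hasGenerator_generator x

theorem shifted_of_hasGenerator {ξ : ℂ} {f g : F} (h : HasGenerator E f g) :
    shifted (generator E) ξ ⟨f, h.mem_domain⟩ = ξ • f - g := by
  rw [shifted_apply, generator_apply (f := ⟨f, h.mem_domain⟩) h]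

theorem opResolvent_apply {ξ : ℂ} (hξ : ξ ∉ opSpectrum (generator E)) {f g : F}
    (h : HasGenerator E f g) : opResolvent (generator E) ξ hξ (ξ • f - g) = f := by
  obtain ⟨x, h1, h2⟩ := opResolvent_spec hξ (ξ • f - g)
  rw [← shifted_of_hasGenerator h] at h2
  rw [h1, (not_not.mp hξ).1 h2]

theorem notMem_opSpectrum {ξ : ℂ} (hinj : ∀ f, HasGenerator E f (ξ • f) → f = 0)
    (hsurj : ∀ g, ∃ f, HasGenerator E f (ξ • f - g)) : ξ ∉ opSpectrum (generator E) := by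
  refine not_not.2 ⟨?_, fun g => ?_⟩
  · refine (injective_iff_map_eq_zero _).2 fun f hf => ?_
    rw [shifted_apply, sub_eq_zero] at hf
    have := hasGenerator_generator f
    rw [← hf] at this
    exact Subtype.ext (hinj _ this)
  · obtain ⟨f, hf⟩ := hsurj g
    refine ⟨⟨f, hf.mem_domain⟩, ?_⟩
    rw [shifted_of_hasGenerator hf, sub_sub_cancel]

/-- The resolvent family of a sectorial generator on the open right half-plane. -/
theorem SectorialBound.exists_resolvent {δ C : ℝ} (hδ : 0 < δ)
    (h : SectorialBound (generator E) δ C) :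
    ∃ R : ℂ → F →L[ℂ] F, ∀ ξ : ℂ, 0 < ξ.re →
      (∀ g, HasGenerator E (R ξ g) (ξ • R ξ g - g)) ∧
      (∀ f g, HasGenerator E f g → R ξ (ξ • f - g) = f) ∧
      (∀ g, ‖R ξ g‖ ≤ C / ‖ξ‖ * ‖g‖) := by
  have hne : ∀ ξ : ℂ, 0 < ξ.re → ξ ≠ 0 ∧ ξ ∉ negSector δ := by
    intro ξ hξ
    refine ⟨fun h0 => by simp [h0] at hξ, fun hn => ?_⟩
    have := Complex.abs_arg_lt_pi_div_two_iff.2 (Or.inl hξ)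
    linarith [hn.2]
  have hmem : ∀ ξ : ℂ, 0 < ξ.re → ξ ∉ opSpectrum (generator E) := by
    intro ξ hξ hs
    rcases h.1 hs with h1 | h1
    · exact (hne ξ hξ).2 h1
    · exact (hne ξ hξ).1 h1
  have hR : ∀ ξ : ℂ, ∃ R : F →L[ℂ] F, 0 < ξ.re →
      (∀ g, HasGenerator E (R g) (ξ • R g - g)) ∧
      (∀ f g, HasGenerator E f g → R (ξ • f - g) = f) ∧
      (∀ g, ‖R g‖ ≤ C / ‖ξ‖ * ‖g‖) := by
    intro ξ
    by_cases hξ : 0 < ξ.re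
    · refine ⟨(opResolvent (generator E) ξ (hmem ξ hξ)).mkContinuous (C / ‖ξ‖)
        (h.2 ξ (hmem ξ hξ) (hne ξ hξ).1 (hne ξ hξ).2), fun _ => ⟨?_, ?_, ?_⟩⟩
      · exact hasGenerator_opResolvent (hmem ξ hξ)
      · exact fun f g hfg => opResolvent_apply (hmem ξ hξ) hfg
      · exact h.2 ξ (hmem ξ hξ) (hne ξ hξ).1 (hne ξ hξ).2
    · exact ⟨0, fun h0 => absurd h0 hξ⟩
  choose R hR using hR
  exact ⟨R, hR⟩

end Generator

namespace IsC0Semigroup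

variable {F : Type*} [NormedAddCommGroup F] [NormedSpace ℂ F] {E : ℝ → F →L[ℂ] F}

/-- The weight `t ^ n e ^ (- ξ t)` of the Laplace transform. -/
noncomputable def weight (n : ℕ) (ξ : ℂ) (t : ℝ) : ℂ := (t : ℂ) ^ n * Complex.exp (-(ξ * t))

theorem continuous_weight (n : ℕ) (ξ : ℂ) : Continuous (weight n ξ) := by
  unfold weight; fun_prop

theorem norm_weight (n : ℕ) (ξ : ℂ) {t : ℝ} (ht : 0 ≤ t) :
    ‖weight n ξ t‖ = t ^ n * Real.exp (-(ξ.re * t)) := by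
  rw [weight, norm_mul, norm_pow, Complex.norm_exp, Complex.norm_real, Real.norm_of_nonneg ht]
  simp

theorem norm_weight_smul_le {M ω : ℝ} (hM : ∀ t : ℝ, 0 ≤ t → ‖E t‖ ≤ M * Real.exp (ω * t))
    (n : ℕ) (ξ : ℂ) (f : F) {t : ℝ} (ht : 0 ≤ t) :
    ‖weight n ξ t • E t f‖ ≤ M * ‖f‖ * (t ^ (n : ℝ) * Real.exp (-(ξ.re - ω) * t)) := by
  rw [norm_smul, norm_weight n ξ ht, Real.rpow_natCast]
  have h1 := (E t).le_of_opNorm_le (hM t ht) f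
  have h2 : Real.exp (-(ξ.re - ω) * t) = Real.exp (-(ξ.re * t)) * Real.exp (ω * t) := by
    rw [← Real.exp_add]; congr 1; ring
  rw [h2]
  calc _ ≤ t ^ n * Real.exp (-(ξ.re * t)) * (M * Real.exp (ω * t) * ‖f‖) := by gcongr
    _ = _ := by ring

theorem integrableOn_weight_smul [CompleteSpace F] (hE : IsC0Semigroup E) {M ω : ℝ}
    (hM : ∀ t : ℝ, 0 ≤ t → ‖E t‖ ≤ M * Real.exp (ω * t))
    (n : ℕ) {ξ : ℂ} (hξ : ω < ξ.re) (f : F) :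
    IntegrableOn (fun t => weight n ξ t • E t f) (Ioi 0) := by
  have h1 := (integrableOn_rpow_mul_exp_neg_mul_rpow (s := n) (p := 1) (b := ξ.re - ω)
    (by have := (Nat.cast_nonneg n : (0 : ℝ) ≤ n); linarith) one_pos
    (sub_pos.2 hξ)).const_mul (M * ‖f‖)
  refine Integrable.mono' h1 ?_ ?_
  · refine ContinuousOn.aestronglyMeasurable ?_ measurableSet_Ioi
    exact (continuous_weight n ξ).continuousOn.smul
      ((hE.continuousOn f).mono Ioi_subset_Ici_self)
  · filter_upwards [ae_restrict_mem measurableSet_Ioi] with t ht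
    simpa using norm_weight_smul_le hM n ξ f (le_of_lt ht)

theorem tendsto_weight_smul {M ω : ℝ} (hM : ∀ t : ℝ, 0 ≤ t → ‖E t‖ ≤ M * Real.exp (ω * t))
    (n : ℕ) {ξ : ℂ} (hξ : ω < ξ.re) (f : F) :
    Tendsto (fun t => weight n ξ t • E t f) atTop (𝓝 0) := by
  have h1 := (tendsto_rpow_mul_exp_neg_mul_atTop_nhds_zero n (ξ.re - ω)
    (sub_pos.2 hξ)).const_mul (M * ‖f‖)
  rw [mul_zero] at h1
  refine squeeze_zero_norm' ?_ h1
  filter_upwards [eventually_ge_atTop 0] with t ht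
  exact norm_weight_smul_le hM n ξ f ht

/-- `∫₀^∞ t ^ n e ^ (- ξ t) E_t f dt`. -/
noncomputable def laplace (E : ℝ → F →L[ℂ] F) (n : ℕ) (ξ : ℂ) (f : F) : F :=
  ∫ t in Ioi (0 : ℝ), weight n ξ t • E t f

theorem hasDerivAt_weight_zero (ξ : ℂ) (t : ℝ) :
    HasDerivAt (weight 0 ξ) (-(ξ * weight 0 ξ t)) t := by
  have h1 : HasDerivAt (fun z : ℂ => Complex.exp (-(ξ * z)))
      (Complex.exp (-(ξ * t)) * -(ξ * 1)) t :=
    (((hasDerivAt_id (t : ℂ)).const_mul ξ).neg).cexp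
  have h2 := h1.comp_ofReal
  unfold weight
  simp only [pow_zero, one_mul]
  convert h2 using 1
  ring

theorem hasDerivAt_weight_succ (n : ℕ) (ξ : ℂ) (t : ℝ) :
    HasDerivAt (weight (n + 1) ξ) ((n + 1) * weight n ξ t - ξ * weight (n + 1) ξ t) t := by
  have h1 : HasDerivAt (fun z : ℂ => Complex.exp (-(ξ * z)))
      (Complex.exp (-(ξ * t)) * -(ξ * 1)) t :=
    (((hasDerivAt_id (t : ℂ)).const_mul ξ).neg).cexp
  have h2 := ((hasDerivAt_pow (n + 1) (t : ℂ)).mul h1).comp_ofReal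
  refine h2.congr_deriv ?_
  rw [weight, weight, Nat.add_sub_cancel]
  push_cast
  ring

theorem laplace_zero_apply [CompleteSpace F] (hE : IsC0Semigroup E) {M ω : ℝ}
    (hM : ∀ t : ℝ, 0 ≤ t → ‖E t‖ ≤ M * Real.exp (ω * t)) {ξ : ℂ} (hξ : ω < ξ.re) {f g : F}
    (h : HasGenerator E f g) : laplace E 0 ξ (ξ • f - g) = f := by
  have hd : ∀ t ∈ Ioi (0 : ℝ), HasDerivAt (fun t => weight 0 ξ t • E t f)
      (-(weight 0 ξ t • E t (ξ • f - g))) t := by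
    intro t ht
    refine ((hasDerivAt_weight_zero ξ t).smul (hE.hasDerivAt h ht)).congr_deriv ?_
    rw [map_sub, map_smul, smul_sub, smul_smul, neg_smul, mul_comm ξ]; abel
  have h0 := integral_Ioi_of_hasDerivAt_of_tendsto
    (((continuous_weight 0 ξ).continuousWithinAt).smul (hE.continuousOn f 0 self_mem_Ici)) hd
    (hE.integrableOn_weight_smul hM 0 hξ _).neg (tendsto_weight_smul hM 0 hξ f)
  rw [integral_neg, zero_sub, neg_inj] at h0
  rw [laplace, h0]
  simp [weight, hE.apply_zero]

theorem laplace_succ_apply [CompleteSpace F] (hE : IsC0Semigroup E) {M ω : ℝ}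
    (hM : ∀ t : ℝ, 0 ≤ t → ‖E t‖ ≤ M * Real.exp (ω * t)) (n : ℕ) {ξ : ℂ} (hξ : ω < ξ.re)
    {f g : F} (h : HasGenerator E f g) :
    laplace E (n + 1) ξ (ξ • f - g) = ((n + 1 : ℕ) : ℂ) • laplace E n ξ f := by
  have hd : ∀ t ∈ Ioi (0 : ℝ), HasDerivAt (fun t => weight (n + 1) ξ t • E t f)
      (((n + 1 : ℕ) : ℂ) • weight n ξ t • E t f - weight (n + 1) ξ t • E t (ξ • f - g)) t := by
    intro t ht
    refine ((hasDerivAt_weight_succ n ξ t).smul (hE.hasDerivAt h ht)).congr_deriv ?_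
    rw [map_sub, map_smul, smul_sub, smul_smul, smul_smul, sub_smul, mul_comm ξ]; push_cast; abel
  have i1 := hE.integrableOn_weight_smul hM (n + 1) hξ (ξ • f - g)
  have i2 : IntegrableOn (fun t => ((n + 1 : ℕ) : ℂ) • weight n ξ t • E t f) (Ioi 0) :=
    (hE.integrableOn_weight_smul hM n hξ f).smul ((n + 1 : ℕ) : ℂ)
  have h0 := integral_Ioi_of_hasDerivAt_of_tendsto
    (((continuous_weight (n + 1) ξ).continuousWithinAt).smul
      (hE.continuousOn f 0 self_mem_Ici)) hd (i2.sub i1) (tendsto_weight_smul hM (n + 1) hξ f)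
  rw [integral_sub i2 i1] at h0
  have h1 : weight (n + 1) ξ 0 = 0 := by simp [weight]
  rw [Pi.smul_apply', h1, zero_smul, sub_zero, sub_eq_zero, integral_smul] at h0
  exact h0.symm

/-- The Laplace transform of `t ^ n E_t` is `n!` times the `(n + 1)`st power of the resolvent. -/
theorem laplace_eq [CompleteSpace F] (hE : IsC0Semigroup E) {M ω : ℝ}
    (hM : ∀ t : ℝ, 0 ≤ t → ‖E t‖ ≤ M * Real.exp (ω * t)) {ξ : ℂ} (hξ : ω < ξ.re)
    {R : F →L[ℂ] F} (hR : ∀ g, HasGenerator E (R g) (ξ • R g - g)) (n : ℕ) (g : F) :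
    laplace E n ξ g = (n.factorial : ℂ) • (R ^ (n + 1)) g := by
  induction n generalizing g with
  | zero =>
    have := hE.laplace_zero_apply hM hξ (hR g)
    rw [sub_sub_cancel] at this
    simpa using this
  | succ n ih =>
    have := hE.laplace_succ_apply hM n hξ (hR g)
    rw [sub_sub_cancel] at this
    rw [this, ih, smul_smul, Nat.factorial_succ, pow_succ R (n + 1), Nat.cast_mul]
    rfl

theorem integrable_inv_sq_add_sq {c : ℝ} (hc : 0 < c) :
    Integrable (fun s : ℝ => (c ^ 2 + s ^ 2)⁻¹) ∧ ∫ s : ℝ, (c ^ 2 + s ^ 2)⁻¹ = Real.pi / c := by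
  have h : (fun s : ℝ => (c ^ 2 + s ^ 2)⁻¹) = fun s => (c ^ 2)⁻¹ * (1 + (c⁻¹ * s) ^ 2)⁻¹ := by
    ext s
    rw [← mul_inv]
    congr 1
    field_simp
  rw [h]
  refine ⟨(integrable_inv_one_add_sq.comp_mul_left' (inv_ne_zero hc.ne')).const_mul _, ?_⟩
  rw [integral_const_mul, Measure.integral_comp_mul_left (fun s : ℝ => (1 + s ^ 2)⁻¹),
    integral_univ_inv_one_add_sq, inv_inv, abs_of_pos hc, smul_eq_mul]
  field_simp

open scoped FourierTransform

theorem norm_le_of_fourier_bound [CompleteSpace F] {g : ℝ → F} (hg : Continuous g)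
    (hi : Integrable g) {c D : ℝ} (hc : 0 < c)
    (hD : ∀ s : ℝ, ‖𝓕 g s‖ ≤ D * (c ^ 2 + s ^ 2)⁻¹) (t : ℝ) : ‖g t‖ ≤ D * (Real.pi / c) := by
  have hcont : Continuous (𝓕 g) :=
    VectorFourier.fourierIntegral_continuous Real.continuous_fourierChar
      (innerSL ℝ).continuous₂ hi
  have hint : Integrable (𝓕 g) :=
    ((integrable_inv_sq_add_sq hc).1.const_mul D).mono' hcont.aestronglyMeasurable
      (Eventually.of_forall hD)
  rw [← hg.fourierInv_fourier_eq hi hint, Real.fourierInv_eq]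
  refine (norm_integral_le_integral_norm _).trans ?_
  simp_rw [Circle.norm_smul]
  refine (integral_mono hint.norm ((integrable_inv_sq_add_sq hc).1.const_mul D) hD).trans_eq ?_
  rw [integral_const_mul, (integrable_inv_sq_add_sq hc).2]

theorem norm_pow_apply_le {ξ : ℂ} {R : F →L[ℂ] F} {C : ℝ} (hC : 0 ≤ C)
    (hR : ∀ f g, HasGenerator E f g → R (ξ • f - g) = f)
    (hRC : ∀ g, ‖ξ‖ * ‖R g‖ ≤ C * ‖g‖) {n : ℕ} {b : ℕ → F}
    (hb : ∀ k < n, HasGenerator E (b k) (b (k + 1))) (m : ℕ) :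
    ‖(R ^ (m + n)) (b n)‖ ≤ (C + 1) ^ n * ‖(R ^ m) (b 0)‖ := by
  induction n with
  | zero => simp
  | succ n ih =>
    have h1 : R (b (n + 1)) = ξ • R (b n) - b n := by
      have := hR _ _ (hb n n.lt_succ_self)
      rw [map_sub, map_smul, sub_eq_iff_eq_add] at this
      rw [this]; abel
    have h2 : (R ^ (m + (n + 1))) (b (n + 1)) =
        ξ • R ((R ^ (m + n)) (b n)) - (R ^ (m + n)) (b n) := by
      rw [← add_assoc, pow_succ, mul_apply_eq_comp, h1, map_sub, map_smul]
      congr 2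
      rw [← mul_apply_eq_comp, ← mul_apply_eq_comp, ← pow_succ, pow_succ']
    rw [h2]
    refine (norm_sub_le _ _).trans ?_
    rw [norm_smul]
    have h3 := hRC ((R ^ (m + n)) (b n))
    have h4 := ih fun k hk => hb k (hk.trans n.lt_succ_self)
    calc _ ≤ (C + 1) * ‖(R ^ (m + n)) (b n)‖ := by linarith
      _ ≤ (C + 1) * ((C + 1) ^ n * ‖(R ^ m) (b 0)‖) := by gcongr
      _ = _ := by ring

/-- The resolvent hypothesis on the right half-plane. -/
def ResolventFamily (E : ℝ → F →L[ℂ] F) (R : ℂ → F →L[ℂ] F) (C : ℝ) : Prop :=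
  ∀ ξ : ℂ, 0 < ξ.re →
      (∀ g, HasGenerator E (R ξ g) (ξ • R ξ g - g)) ∧
      (∀ f g, HasGenerator E f g → R ξ (ξ • f - g) = f) ∧
      (∀ g, ‖R ξ g‖ ≤ C / ‖ξ‖ * ‖g‖)

theorem norm_sq_apply_le {ξ : ℂ} (hξ : ξ ≠ 0) {R : F →L[ℂ] F} {C : ℝ} (hC : 0 ≤ C)
    (hRC : ∀ g, ‖ξ‖ * ‖R g‖ ≤ C * ‖g‖) (f : F) :
    ‖(R ^ 2) f‖ ≤ C ^ 2 * (‖ξ‖ ^ 2)⁻¹ * ‖f‖ := by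
  have h0 : 0 < ‖ξ‖ := norm_pos_iff.2 hξ
  rw [pow_two, mul_apply_eq_comp]
  have h1 := hRC f
  have h2 := hRC (R f)
  have h3 : ‖ξ‖ ^ 2 * ‖R (R f)‖ ≤ C ^ 2 * ‖f‖ := by
    calc ‖ξ‖ ^ 2 * ‖R (R f)‖ = ‖ξ‖ * (‖ξ‖ * ‖R (R f)‖) := by ring
      _ ≤ ‖ξ‖ * (C * ‖R f‖) := by gcongr
      _ = C * (‖ξ‖ * ‖R f‖) := by ring
      _ ≤ C * (C * ‖f‖) := by gcongr
      _ = _ := by ring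
  rw [mul_right_comm, ← div_eq_mul_inv, le_div_iff₀ (by positivity), mul_comm]
  exact h3

/-- Fourier inversion on the line `Re ξ = c` for the Laplace transform of `t ^ (n + 1) E_t`. -/
theorem norm_apply_le_of_growth [CompleteSpace F] (hE : IsC0Semigroup E)
    {R : ℂ → F →L[ℂ] F} {C : ℝ} (hC : 0 ≤ C) (hR : ResolventFamily E R C) {M ω : ℝ}
    (hM : ∀ t : ℝ, 0 ≤ t → ‖E t‖ ≤ M * Real.exp (ω * t)) {c : ℝ} (hc : 0 < c) (hcω : ω < c)
    {n : ℕ} {b : ℕ → F} (hb : ∀ k < n, HasGenerator E (b k) (b (k + 1))) {t : ℝ} (ht : 0 < t) :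
    t ^ (n + 1) * ‖E t (b n)‖ ≤ (n + 1).factorial * (C + 1) ^ n * C ^ 2 * ‖b 0‖ *
      (Real.pi / c) * Real.exp (c * t) := by
  set g : ℝ → F := fun t => weight (n + 1) c (max t 0) • E (max t 0) (b n) with hg
  have hcont : Continuous g :=
    ((continuous_weight (n + 1) c).comp (by fun_prop)).smul (hE.continuous_max (b n))
  have hsupp : ∀ t ∉ Ioi (0 : ℝ), g t = 0 := by
    intro t ht
    simp [hg, weight, not_lt.1 (mt mem_Ioi.2 ht)]
  have hpos : ∀ t ∈ Ioi (0 : ℝ), g t = weight (n + 1) c t • E t (b n) := by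
    intro t ht
    rw [hg]
    simp only [max_eq_left (le_of_lt (mem_Ioi.1 ht))]
  have hint : Integrable g := by
    rw [← integrableOn_iff_integrable_of_support_subset (s := Ioi 0)
      (fun t ht => by_contra fun h => ht (hsupp t h))]
    exact (hE.integrableOn_weight_smul hM (n + 1) (ξ := c) (by simpa using hcω) (b n)).congr_fun
      (fun t ht => (hpos t ht).symm) measurableSet_Ioi
  have hF : ∀ s : ℝ, 𝓕 g s = ((n + 1).factorial : ℂ) •
      (R (c + 2 * Real.pi * s * Complex.I) ^ (2 + n)) (b n) := by
    intro s
    have hre : (c + 2 * Real.pi * s * Complex.I : ℂ).re = c := by simp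
    rw [add_comm 2 n, ← hE.laplace_eq hM (by rw [hre]; exact hcω) (hR _ (by rw [hre]; exact hc)).1,
      Real.fourier_real_eq_integral_exp_smul, laplace,
      ← setIntegral_eq_integral_of_forall_compl_eq_zero (s := Ioi 0)
        (fun t ht => by rw [hsupp t ht, smul_zero])]
    refine setIntegral_congr_fun measurableSet_Ioi fun t ht => ?_
    rw [hpos t ht, smul_smul]
    congr 1
    rw [weight, weight, mul_left_comm, ← Complex.exp_add]
    congr 2
    push_cast
    ring
  have hD : ∀ s : ℝ, ‖𝓕 g s‖ ≤
      ((n + 1).factorial * (C + 1) ^ n * C ^ 2 * ‖b 0‖) * (c ^ 2 + s ^ 2)⁻¹ := by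
    intro s
    rw [hF, norm_smul, Complex.norm_natCast]
    set ξ : ℂ := c + 2 * Real.pi * s * Complex.I with hξ
    have hre : ξ.re = c := by simp [hξ]
    have him : ξ.im = 2 * Real.pi * s := by simp [hξ]
    obtain ⟨-, h2, h3⟩ := hR ξ (by rw [hre]; exact hc)
    have h0 : ξ ≠ 0 := fun h => by rw [h] at hre; simp at hre; exact hc.ne hre
    have h3' : ∀ g, ‖ξ‖ * ‖R ξ g‖ ≤ C * ‖g‖ := fun g => by
      have := h3 g
      rwa [div_mul_eq_mul_div, le_div_iff₀ (norm_pos_iff.2 h0), mul_comm] at this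
    have h4 := norm_pow_apply_le hC h2 h3' hb 2
    have h5 := norm_sq_apply_le h0 hC h3' (b 0)
    have h6 : (‖ξ‖ ^ 2)⁻¹ ≤ (c ^ 2 + s ^ 2)⁻¹ := by
      refine inv_anti₀ (by positivity) ?_
      rw [Complex.sq_norm, Complex.normSq_apply, hre, him]
      have hp : 1 ≤ (2 * Real.pi) ^ 2 := by
        have := Real.pi_gt_three
        nlinarith
      nlinarith [sq_nonneg s]
    calc _ ≤ ((n + 1).factorial : ℝ) * ((C + 1) ^ n * (C ^ 2 * (‖ξ‖ ^ 2)⁻¹ * ‖b 0‖)) := by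
          refine mul_le_mul_of_nonneg_left (h4.trans ?_) (by positivity)
          gcongr
      _ ≤ ((n + 1).factorial : ℝ) * ((C + 1) ^ n * (C ^ 2 * (c ^ 2 + s ^ 2)⁻¹ * ‖b 0‖)) := by
          gcongr
      _ = _ := by ring
  have hfin := norm_le_of_fourier_bound hcont hint hc hD t
  rw [hpos t ht, norm_smul, norm_weight _ _ ht.le, Complex.ofReal_re] at hfin
  have he : Real.exp (-(c * t)) * Real.exp (c * t) = 1 := by
    rw [← Real.exp_add]; simp
  calc t ^ (n + 1) * ‖E t (b n)‖
      = (t ^ (n + 1) * Real.exp (-(c * t)) * ‖E t (b n)‖) * Real.exp (c * t) := by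
        linear_combination (-(t ^ (n + 1) * ‖E t (b n)‖)) * he
    _ ≤ _ := by gcongr

end IsC0Semigroup

namespace IsC0Semigroup

variable {F : Type*} [NormedAddCommGroup F] [NormedSpace ℂ F] {E : ℝ → F →L[ℂ] F}

/-- The exponential growth rate of a semigroup with resolvent bound `C / ‖ξ‖` on the right
half-plane can be lowered by a factor depending on `C` only. -/
theorem growth_step [CompleteSpace F] (hE : IsC0Semigroup E)
    {R : ℂ → F →L[ℂ] F} {C : ℝ} (hC : 0 ≤ C) (hR : ResolventFamily E R C) {M ω : ℝ} (hω : 0 < ω)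
    (hM : ∀ t : ℝ, 0 ≤ t → ‖E t‖ ≤ M * Real.exp (ω * t)) :
    ∃ M' : ℝ, ∀ t : ℝ, 0 ≤ t →
      ‖E t‖ ≤ M' * Real.exp ((1 - (Real.exp 1 * (C ^ 2 * Real.pi + 1))⁻¹) * ω * t) := by
  set A := C ^ 2 * Real.pi + 1 with hA
  have hA0 : 0 < A := by have := Real.pi_pos; positivity
  have he : 0 < Real.exp 1 := Real.exp_pos 1
  set T := Real.exp 1 * A / ω with hT
  have hT0 : 0 < T := by positivity
  obtain ⟨M₁, hM₁⟩ := hE.exists_bound_Icc T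
  refine hE.exists_bound_of_norm_le_exp hT0 hM₁ ?_
  refine ContinuousLinearMap.opNorm_le_bound _ (Real.exp_nonneg _) fun f => ?_
  have h1 : T * ‖E T f‖ ≤ C ^ 2 * ‖f‖ * (Real.pi / ω) * Real.exp (ω * T) := by
    have hlim : Tendsto (fun c : ℝ => C ^ 2 * ‖f‖ * (Real.pi / c) * Real.exp (c * T)) (𝓝[>] ω)
        (𝓝 (C ^ 2 * ‖f‖ * (Real.pi / ω) * Real.exp (ω * T))) := by
      refine Tendsto.mono_left ?_ nhdsWithin_le_nhds
      have : ContinuousAt (fun c : ℝ => C ^ 2 * ‖f‖ * (Real.pi / c) * Real.exp (c * T)) ω := by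
        have := hω.ne'
        fun_prop (disch := assumption)
      exact this
    refine ge_of_tendsto hlim ?_
    filter_upwards [self_mem_nhdsWithin] with c hc
    have := hE.norm_apply_le_of_growth hC hR hM (hω.trans hc) hc (n := 0) (b := fun _ => f)
      (fun k hk => absurd hk (Nat.not_lt_zero k)) hT0
    simpa using this
  have h2 : (1 - (Real.exp 1 * A)⁻¹) * ω * T = ω * T - 1 := by
    rw [hT]; field_simp
  rw [h2, Real.exp_sub]
  have h3 : C ^ 2 * ‖f‖ * (Real.pi / ω) * Real.exp (ω * T) ≤
      T * (Real.exp (ω * T) / Real.exp 1 * ‖f‖) := by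
    have : T * (Real.exp (ω * T) / Real.exp 1 * ‖f‖) =
        A / ω * Real.exp (ω * T) * ‖f‖ := by
      rw [hT]; field_simp
    rw [this]
    calc _ = (C ^ 2 * Real.pi) / ω * Real.exp (ω * T) * ‖f‖ := by ring
      _ ≤ _ := by gcongr; linarith
  exact le_of_mul_le_mul_left (h1.trans h3) hT0

/-- A resolvent bound `C / ‖ξ‖` on the right half-plane forces subexponential growth. -/
theorem exists_growth [CompleteSpace F] (hE : IsC0Semigroup E)
    {R : ℂ → F →L[ℂ] F} {C : ℝ} (hC : 0 ≤ C) (hR : ResolventFamily E R C) {c : ℝ} (hc : 0 < c) :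
    ∃ ω M : ℝ, ω < c ∧ ∀ t : ℝ, 0 ≤ t → ‖E t‖ ≤ M * Real.exp (ω * t) := by
  obtain ⟨ω, M, hω, hM⟩ := hE.exists_exp_bound
  have hx : 1 < Real.exp 1 * (C ^ 2 * Real.pi + 1) := by
    have h1 : 1 < Real.exp 1 := by simp
    have := Real.pi_pos
    have h2 : 1 ≤ C ^ 2 * Real.pi + 1 := by
      have : 0 ≤ C ^ 2 * Real.pi := by positivity
      linarith
    nlinarith
  set q := 1 - (Real.exp 1 * (C ^ 2 * Real.pi + 1))⁻¹
  have hq0 : 0 < q := sub_pos.2 (inv_lt_one_of_one_lt₀ hx)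
  have hq1 : q < 1 := sub_lt_self _ (inv_pos.2 (zero_lt_one.trans hx))
  have key : ∀ k : ℕ, ∃ M : ℝ, ∀ t : ℝ, 0 ≤ t → ‖E t‖ ≤ M * Real.exp (q ^ k * ω * t) := by
    intro k
    induction k with
    | zero => exact ⟨M, by simpa using hM⟩
    | succ k ih =>
      obtain ⟨M₁, h₁⟩ := ih
      obtain ⟨M₂, h₂⟩ := hE.growth_step hC hR (by positivity) h₁
      refine ⟨M₂, fun t ht => ?_⟩
      rw [pow_succ' q k, mul_assoc q]
      exact h₂ t ht
  have hlim : Tendsto (fun k : ℕ => q ^ k * ω) atTop (𝓝 0) := by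
    simpa using (tendsto_pow_atTop_nhds_zero_of_lt_one hq0.le hq1).mul_const ω
  obtain ⟨k, hk⟩ := (hlim.eventually (gt_mem_nhds hc)).exists
  obtain ⟨M', hM'⟩ := key k
  exact ⟨_, M', hk, hM'⟩

theorem norm_apply_chain_le [CompleteSpace F] (hE : IsC0Semigroup E)
    {R : ℂ → F →L[ℂ] F} {C : ℝ} (hC : 0 ≤ C) (hR : ResolventFamily E R C)
    {n : ℕ} {b : ℕ → F} (hb : ∀ k < n, HasGenerator E (b k) (b (k + 1))) {t : ℝ} (ht : 0 < t) :
    t ^ n * ‖E t (b n)‖ ≤ (C ^ 2 * Real.pi * Real.exp 1) *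
      ((n + 1).factorial * (C + 1) ^ n * ‖b 0‖) := by
  obtain ⟨ω, M, hω, hM⟩ := hE.exists_growth hC hR (inv_pos.2 ht)
  have h := hE.norm_apply_le_of_growth hC hR hM (inv_pos.2 ht) hω hb ht
  rw [inv_mul_cancel₀ ht.ne', div_inv_eq_mul] at h
  refine le_of_mul_le_mul_left (a := t) ?_ ht
  calc _ = t ^ (n + 1) * ‖E t (b n)‖ := by ring
    _ ≤ _ := h
    _ = _ := by ring

/-- The semigroup maps into the domain of its generator at positive times. -/
theorem exists_hasGenerator_apply [CompleteSpace F] (hE : IsC0Semigroup E)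
    {R : ℂ → F →L[ℂ] F} {C : ℝ} (hC : 0 ≤ C) (hR : ResolventFamily E R C) {t : ℝ} (ht : 0 < t)
    (f : F) : ∃ g, HasGenerator E (E t f) g := by
  obtain ⟨u, v, huv, hu⟩ := hE.exists_seq_hasGenerator f
  have hc : CauchySeq fun n => E t (v n) := by
    set K := t⁻¹ * ((C ^ 2 * Real.pi * Real.exp 1) * (2 * (C + 1)))
    have hK : ∀ m n, ‖E t (v m) - E t (v n)‖ ≤ K * ‖u m - u n‖ := by
      intro m n
      have hd : HasGenerator E (u m - u n) (v m - v n) := by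
        have := (huv m).add ((huv n).smul (-1))
        simpa [sub_eq_add_neg] using this
      have := hE.norm_apply_chain_le hC hR (n := 1)
        (b := fun k => if k = 0 then u m - u n else v m - v n)
        (fun k hk => by
          obtain rfl : k = 0 := by omega
          simpa using hd) ht
      simp only [pow_one, one_ne_zero, if_false, if_true, map_sub] at this
      rw [mul_assoc, ← div_eq_inv_mul, le_div_iff₀ ht, mul_comm]
      refine this.trans_eq ?_
      norm_num [Nat.factorial]
      ring
    have hu' := cauchySeq_iff_tendsto_dist_atTop_0.1 hu.cauchySeq
    refine cauchySeq_iff_tendsto_dist_atTop_0.2 (squeeze_zero (fun _ => dist_nonneg)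
      (fun p => ?_) (by simpa using hu'.const_mul K))
    rw [dist_eq_norm, dist_eq_norm]
    exact hK _ _
  obtain ⟨g, hg⟩ := cauchySeq_tendsto_of_complete hc
  exact ⟨g, hE.hasGenerator_of_tendsto
    (Eventually.of_forall fun n => hE.hasGenerator_apply (huv n) ht.le)
    (((E t).continuous.tendsto f).comp hu) hg⟩

theorem genPow_succ (n : ℕ) (f : F) :
    genPow (generator E) (n + 1) f = extendZero (generator E) (genPow (generator E) n f) :=
  Function.iterate_succ_apply' _ _ _

theorem genPow_zero (f : F) : genPow (generator E) 0 f = f := rfl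

theorem genPow_eq_of_chain {n : ℕ} {b : ℕ → F} (hb : ∀ k < n, HasGenerator E (b k) (b (k + 1))) :
    genPow (generator E) n (b 0) = b n := by
  induction n with
  | zero => rfl
  | succ n ih =>
    rw [genPow_succ, ih fun k hk => hb k (hk.trans n.lt_succ_self),
      (hb n n.lt_succ_self).extendZero_eq]

/-- A semigroup whose operators map into the domain of the generator at positive times. -/
def IsSmoothing (E : ℝ → F →L[ℂ] F) : Prop :=
  ∀ t : ℝ, 0 < t → ∀ f, ∃ g, HasGenerator E (E t f) g

theorem genPow_add_apply_of_chain (hE : IsC0Semigroup E) {n : ℕ} {s t : ℝ} (hs : 0 ≤ s)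
    (ht : 0 ≤ t) {f : F}
    (h : ∀ k < n, HasGenerator E (genPow (generator E) k (E t f))
      (genPow (generator E) (k + 1) (E t f))) :
    genPow (generator E) n (E (s + t) f) = E s (genPow (generator E) n (E t f)) := by
  rw [hE.apply_add hs ht]
  exact genPow_eq_of_chain (b := fun k => E s (genPow (generator E) k (E t f)))
    fun k hk => hE.hasGenerator_apply (h k hk) hs

theorem hasGenerator_genPow (hE : IsC0Semigroup E) (hS : IsSmoothing E) (n : ℕ) {t : ℝ}
    (ht : 0 < t) (f : F) :
    HasGenerator E (genPow (generator E) n (E t f)) (genPow (generator E) (n + 1) (E t f)) := by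
  induction n using Nat.strong_induction_on generalizing t f with
  | _ n ih =>
    have h1 : t = t / 2 + t / 2 := by ring
    have h2 : 0 < t / 2 := by positivity
    have h3 : genPow (generator E) n (E t f) =
        E (t / 2) (genPow (generator E) n (E (t / 2) f)) := by
      conv_lhs => rw [h1]
      exact hE.genPow_add_apply_of_chain h2.le h2.le fun k hk => ih k hk h2 f
    obtain ⟨g, hg⟩ := hS (t / 2) h2 (genPow (generator E) n (E (t / 2) f))
    rw [← h3] at hg
    rwa [genPow_succ, hg.extendZero_eq]

theorem genPow_add_apply (hE : IsC0Semigroup E) (hS : IsSmoothing E) (n : ℕ) {s t : ℝ}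
    (hs : 0 ≤ s) (ht : 0 < t) (f : F) :
    genPow (generator E) n (E (s + t) f) = E s (genPow (generator E) n (E t f)) :=
  hE.genPow_add_apply_of_chain hs ht.le fun k _ => hE.hasGenerator_genPow hS k ht f

theorem hasDerivAt_genPow [CompleteSpace F] (hE : IsC0Semigroup E) (hS : IsSmoothing E) (n : ℕ)
    {t : ℝ} (ht : 0 < t) (f : F) :
    HasDerivAt (fun s => genPow (generator E) n (E s f)) (genPow (generator E) (n + 1) (E t f))
      t := by
  have h2 : 0 < t / 2 := by positivity
  have h1 := hE.hasDerivAt (hE.hasGenerator_genPow hS n h2 f) h2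
  have h3 : HasDerivAt (fun s => E (s - t / 2) (genPow (generator E) n (E (t / 2) f)))
      (E (t / 2) (genPow (generator E) (n + 1) (E (t / 2) f))) t := by
    refine HasDerivAt.comp_sub_const t (t / 2)
      (f := fun s => E s (genPow (generator E) n (E (t / 2) f))) ?_
    convert h1 using 1
    ring
  rw [← hE.genPow_add_apply hS (n + 1) h2.le h2, add_halves] at h3
  refine h3.congr_of_eventuallyEq ?_
  filter_upwards [Ioi_mem_nhds (show t / 2 < t by linarith)] with s hs
  rw [← hE.genPow_add_apply hS n (sub_nonneg.2 (le_of_lt hs)) h2, sub_add_cancel]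

/-- Bounds `‖B ^ n E_t f‖ ≤ K (n + 1)! (a / t) ^ n ‖f‖` for all powers of the generator. -/
def HasDerivBounds (E : ℝ → F →L[ℂ] F) (K a : ℝ) : Prop :=
  ∀ (n : ℕ) (t : ℝ) (f : F), 0 < t →
    t ^ n * ‖genPow (generator E) n (E t f)‖ ≤ K * ((n + 1).factorial * a ^ n * ‖f‖)

theorem hasDerivBounds [CompleteSpace F] (hE : IsC0Semigroup E)
    {R : ℂ → F →L[ℂ] F} {C : ℝ} (hC : 0 ≤ C) (hR : ResolventFamily E R C) (hS : IsSmoothing E) :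
    HasDerivBounds E (C ^ 2 * Real.pi * Real.exp 1) (C + 1) := by
  intro n t f ht
  set x := genPow (generator E) n (E t f)
  have h1 : Tendsto (fun ε : ℝ => (t - ε) ^ n * ‖x‖) (𝓝[>] 0) (𝓝 (t ^ n * ‖x‖)) := by
    have : Continuous fun ε : ℝ => (t - ε) ^ n * ‖x‖ := by fun_prop
    simpa using (this.tendsto 0).mono_left (nhdsWithin_le_nhds (s := Ioi 0))
  have h2 : Tendsto (fun ε : ℝ => (C ^ 2 * Real.pi * Real.exp 1) *
      ((n + 1).factorial * (C + 1) ^ n * ‖E ε f‖)) (𝓝[>] 0)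
      (𝓝 ((C ^ 2 * Real.pi * Real.exp 1) * ((n + 1).factorial * (C + 1) ^ n * ‖f‖))) :=
    ((hE.continuous_zero f).norm.const_mul _).const_mul _
  refine le_of_tendsto_of_tendsto h1 h2 ?_
  filter_upwards [Ioo_mem_nhdsGT ht] with ε hε
  have h3 : x = E (t - ε) (genPow (generator E) n (E ε f)) := by
    rw [← hE.genPow_add_apply hS n (by linarith [hε.2]) hε.1, sub_add_cancel]
  rw [h3]
  exact hE.norm_apply_chain_le hC hR (b := fun k => genPow (generator E) k (E ε f))
    (fun k _ => hE.hasGenerator_genPow hS k hε.1 f) (sub_pos.2 hε.2)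

theorem hasDerivAt_taylorSum [CompleteSpace F] (hE : IsC0Semigroup E) (hS : IsSmoothing E) (N : ℕ)
    (a : ℝ) {t : ℝ} (ht : 0 < t) (f : F) :
    HasDerivAt (fun s => ∑ k ∈ Finset.range (N + 1),
      ((a - s) ^ k / (k.factorial : ℝ)) • genPow (generator E) k (E s f))
      (((a - t) ^ N / (N.factorial : ℝ)) • genPow (generator E) (N + 1) (E t f)) t := by
  induction N with
  | zero => simpa using hE.hasDerivAt_genPow hS 0 ht f
  | succ N ih =>
    simp_rw [Finset.sum_range_succ _ (N + 1)]
    have h1 : HasDerivAt (fun s : ℝ => (a - s) ^ (N + 1) / ((N + 1).factorial : ℝ))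
        (-((a - t) ^ N / (N.factorial : ℝ))) t := by
      refine ((((hasDerivAt_id t).const_sub a).pow (N + 1)).div_const _).congr_deriv ?_
      rw [Nat.factorial_succ, Nat.add_sub_cancel]
      push_cast
      have : (N.factorial : ℝ) ≠ 0 := by positivity
      simp only [id]
      field_simp
    refine (ih.add (h1.smul (hE.hasDerivAt_genPow hS (N + 1) ht f))).congr_deriv ?_
    rw [neg_smul]
    abel

/-- Forward Taylor expansion of an orbit. -/
theorem tendsto_taylorSum [CompleteSpace F] (hE : IsC0Semigroup E) (hS : IsSmoothing E) {K a : ℝ}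
    (hK : 0 ≤ K) (ha : 0 ≤ a) (hB : HasDerivBounds E K a) {τ h : ℝ} (hτ : 0 < τ) (hh : 0 ≤ h)
    (hlt : h * a < τ) (f : F) :
    Tendsto (fun N => taylorSum (generator E) (E τ f) N h) atTop (𝓝 (E (h + τ) f)) := by
  set r := h * a / τ with hr
  have hr0 : 0 ≤ r := by positivity
  have hr1 : r < 1 := (div_lt_one hτ).2 hlt
  have key : ∀ N : ℕ, ‖E (h + τ) f - taylorSum (generator E) (E τ f) N h‖ ≤
      2 * K * ‖f‖ * (((N + 1 : ℕ) : ℝ) ^ 2 * r ^ (N + 1)) := by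
    intro N
    have hd : ∀ s ∈ Icc τ (h + τ), HasDerivWithinAt (fun s => ∑ k ∈ Finset.range (N + 1),
        ((h + τ - s) ^ k / (k.factorial : ℝ)) • genPow (generator E) k (E s f))
        (((h + τ - s) ^ N / (N.factorial : ℝ)) • genPow (generator E) (N + 1) (E s f))
        (Icc τ (h + τ)) s := fun s hs =>
      (hE.hasDerivAt_taylorSum hS N (h + τ) (hτ.trans_le hs.1) f).hasDerivWithinAt
    have hbd : ∀ s ∈ Icc τ (h + τ),
        ‖((h + τ - s) ^ N / (N.factorial : ℝ)) • genPow (generator E) (N + 1) (E s f)‖ ≤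
        h ^ N / N.factorial * (K * ((N + 2).factorial * a ^ (N + 1) * ‖f‖) / τ ^ (N + 1)) := by
      intro s hs
      rw [norm_smul, Real.norm_of_nonneg (div_nonneg (pow_nonneg (by linarith [hs.2]) _)
        (Nat.cast_nonneg _))]
      have h1 := hB (N + 1) s f (hτ.trans_le hs.1)
      have h2 : ‖genPow (generator E) (N + 1) (E s f)‖ ≤
          K * ((N + 2).factorial * a ^ (N + 1) * ‖f‖) / τ ^ (N + 1) := by
        rw [le_div_iff₀ (by positivity), mul_comm]
        refine le_trans ?_ h1
        gcongr
        exact hs.1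
      have h3 : 0 ≤ h + τ - s := by linarith [hs.2]
      have h4 : h + τ - s ≤ h := by linarith [hs.1]
      gcongr
    have hmv := (convex_Icc τ (h + τ)).norm_image_sub_le_of_norm_hasDerivWithin_le hd hbd
      (left_mem_Icc.2 (by linarith)) (right_mem_Icc.2 (by linarith))
    have e1 : ∑ k ∈ Finset.range (N + 1), ((h + τ - (h + τ)) ^ k / (k.factorial : ℝ)) •
        genPow (generator E) k (E (h + τ) f) = E (h + τ) f := by
      rw [Finset.sum_range_succ']
      simp [genPow_zero]
    have e2 : ∑ k ∈ Finset.range (N + 1), ((h + τ - τ) ^ k / (k.factorial : ℝ)) •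
        genPow (generator E) k (E τ f) = taylorSum (generator E) (E τ f) N h := by
      rw [taylorSum, add_sub_cancel_right]
      exact Finset.sum_congr rfl fun k _ => (Complex.coe_smul _ _).symm
    simp only [e1, e2] at hmv
    refine hmv.trans ?_
    rw [add_sub_cancel_right, Real.norm_of_nonneg hh, Nat.factorial_succ (N + 1),
      Nat.factorial_succ N]
    have hN : (N.factorial : ℝ) ≠ 0 := by positivity
    calc _ = K * ‖f‖ * ((N + 2) * (N + 1) * r ^ (N + 1)) := by
          rw [hr, div_pow, mul_pow]
          push_cast
          field_simp
          ring
      _ ≤ K * ‖f‖ * (2 * (N + 1) * (N + 1) * r ^ (N + 1)) := by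
          gcongr
          linarith [(Nat.cast_nonneg N : (0 : ℝ) ≤ N)]
      _ = _ := by push_cast; ring
  rw [tendsto_iff_norm_sub_tendsto_zero]
  simp_rw [norm_sub_rev _ (E (h + τ) f)]
  have hlim := (tendsto_pow_const_mul_const_pow_of_abs_lt_one 2
    (by rwa [abs_of_nonneg hr0] : |r| < 1)).comp (tendsto_add_atTop_nat 1)
  refine squeeze_zero (fun _ => norm_nonneg _) key ?_
  simpa using hlim.const_mul (2 * K * ‖f‖)

/-- In a nontrivial space the resolvent constant is at least `1`. -/
theorem one_le_of_resolventFamily [CompleteSpace F] [Nontrivial F] (hE : IsC0Semigroup E)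
    {R : ℂ → F →L[ℂ] F} {C : ℝ} (hR : ResolventFamily E R C) : 1 ≤ C := by
  obtain ⟨f, hf⟩ := exists_ne (0 : F)
  obtain ⟨u, v, huv, hu⟩ := hE.exists_seq_hasGenerator f
  obtain ⟨n, hn⟩ := (hu.eventually_ne hf).exists
  set x := u n
  set y := v n
  have h1 : ∀ l : ℝ, 0 < l → ‖x‖ ≤ C * (‖(l : ℂ) • x - y‖ / l) := by
    intro l hl
    obtain ⟨-, h2, h3⟩ := hR l (by simpa using hl)
    have := h3 ((l : ℂ) • x - y)
    rw [h2 _ _ (huv n), Complex.norm_real, Real.norm_of_nonneg hl.le] at this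
    exact this.trans_eq (by ring)
  have h2 : Tendsto (fun l : ℝ => C * ‖x - l⁻¹ • y‖) atTop (𝓝 (C * ‖x‖)) := by
    have := ((tendsto_inv_atTop_zero (𝕜 := ℝ)).smul_const y).const_sub x
    simpa using this.norm.const_mul C
  have h3 : ‖x‖ ≤ C * ‖x‖ := by
    refine ge_of_tendsto h2 ?_
    filter_upwards [eventually_gt_atTop 0] with l hl
    refine (h1 l hl).trans_eq ?_
    congr 1
    have : x - l⁻¹ • y = l⁻¹ • ((l : ℂ) • x - y) := by
      rw [smul_sub, Complex.coe_smul, smul_smul, inv_mul_cancel₀ hl.ne', one_smul]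
    rw [this, norm_smul, Real.norm_of_nonneg (inv_nonneg.2 hl.le)]
    ring
  have h4 : 0 < ‖x‖ := norm_pos_iff.2 hn
  by_contra! h
  nlinarith

end IsC0Semigroup

theorem re_pos_of_mem_posSector {θ : ℝ} (hθ : θ < Real.pi / 2) {z : ℂ}
    (hz : z ∈ posSector θ) : 0 < z.re :=
  (Complex.abs_arg_lt_pi_div_two_iff.1 (hz.2.trans hθ)).resolve_right hz.1

theorem isOpen_posSector {θ : ℝ} (hθ : θ < Real.pi / 2) : IsOpen (posSector θ) := by
  refine isOpen_iff_mem_nhds.2 fun z hz => ?_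
  have h1 : z ∈ Complex.slitPlane := Or.inl (re_pos_of_mem_posSector hθ hz)
  have h2 := (Complex.continuousAt_arg h1).abs.eventually (gt_mem_nhds hz.2)
  filter_upwards [h2, isOpen_ne.mem_nhds hz.1] with w h3 h4
  exact ⟨h4, h3⟩

theorem ofReal_mem_posSector {θ : ℝ} (hθ : 0 < θ) {t : ℝ} (ht : 0 < t) : (t : ℂ) ∈ posSector θ :=
  ⟨by exact_mod_cast ht.ne', by rwa [Complex.arg_ofReal_of_nonneg ht.le, abs_zero]⟩

theorem mem_posSector_iff {θ : ℝ} (hθ : 0 < θ) (hθ' : θ < Real.pi / 2) {z : ℂ} :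
    z ∈ posSector θ ↔ 0 < z.re ∧ |z.im| < Real.tan θ * z.re := by
  have key : 0 < z.re → (|z.arg| < θ ↔ |z.im| < Real.tan θ * z.re) := by
    intro hre
    have h1 := abs_lt.1 (Complex.abs_arg_lt_pi_div_two_iff.2 (Or.inl hre))
    have h2 : |z.im| < Real.tan θ * z.re ↔ |z.im / z.re| < Real.tan θ := by
      rw [abs_div, abs_of_pos hre, div_lt_iff₀ hre]
    rw [h2, ← Complex.tan_arg, abs_lt, abs_lt, ← Real.tan_neg]
    have hm := Real.strictMonoOn_tan
    have k0 : θ ∈ Ioo (-(Real.pi / 2)) (Real.pi / 2) := ⟨by linarith, hθ'⟩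
    have k1 : -θ ∈ Ioo (-(Real.pi / 2)) (Real.pi / 2) := ⟨by linarith, by linarith⟩
    rw [hm.lt_iff_lt k1 h1, hm.lt_iff_lt h1 k0]
  constructor
  · intro h
    have hre := re_pos_of_mem_posSector hθ' h
    exact ⟨hre, (key hre).1 h.2⟩
  · rintro ⟨hre, h⟩
    exact ⟨fun h0 => by simp [h0] at hre, (key hre).2 h⟩

namespace IsC0Semigroup

variable {F : Type*} [NormedAddCommGroup F] [NormedSpace ℂ F] {E : ℝ → F →L[ℂ] F}

/-- The term of order `n` of the Taylor series of the orbit of `f` at `t`. -/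
noncomputable def taylorTerm (E : ℝ → F →L[ℂ] F) (f : F) (t : ℝ) (n : ℕ) (z : ℂ) : F :=
  ((z - t) ^ n / (n.factorial : ℂ)) • genPow (generator E) n (E t f)

/-- The Taylor series of the orbit of `f` at `t`. -/
noncomputable def taylorSeries (E : ℝ → F →L[ℂ] F) (f : F) (t : ℝ) (z : ℂ) : F :=
  ∑' n, taylorTerm E f t n z

theorem norm_taylorTerm_le {K a : ℝ} (ha : 0 < a) (hB : HasDerivBounds E K a) (f : F) {t : ℝ}
    (ht : 0 < t) (n : ℕ) {z : ℂ} (hz : ‖z - t‖ ≤ (2 * a)⁻¹ * t) :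
    ‖taylorTerm E f t n z‖ ≤ K * ‖f‖ * ((n + 1) * (1 / 2) ^ n) := by
  rw [taylorTerm, norm_smul, norm_div, norm_pow, Complex.norm_natCast]
  have h1 := hB n t f ht
  calc ‖z - t‖ ^ n / n.factorial * ‖genPow (generator E) n (E t f)‖
      ≤ ((2 * a)⁻¹ * t) ^ n / n.factorial * ‖genPow (generator E) n (E t f)‖ := by gcongr
    _ = ((2 * a)⁻¹) ^ n / n.factorial * (t ^ n * ‖genPow (generator E) n (E t f)‖) := by
        rw [mul_pow]; ring
    _ ≤ ((2 * a)⁻¹) ^ n / n.factorial * (K * ((n + 1).factorial * a ^ n * ‖f‖)) := by gcongr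
    _ = _ := by
        rw [Nat.factorial_succ, inv_pow, mul_pow, one_div, inv_pow]
        push_cast
        have : (n.factorial : ℝ) ≠ 0 := by positivity
        field_simp

theorem summable_bound (c : ℝ) : Summable fun n : ℕ => c * (((n : ℝ) + 1) * (1 / 2) ^ n) := by
  refine Summable.mul_left c ?_
  have h1 := summable_pow_mul_geometric_of_norm_lt_one 1 (r := (1 / 2 : ℝ)) (by norm_num)
  have h2 := summable_geometric_of_lt_one (r := (1 / 2 : ℝ)) (by norm_num) (by norm_num)
  refine (h1.add h2).congr fun n => ?_
  ring

theorem differentiableOn_taylorSeries [CompleteSpace F] {K a : ℝ} (ha : 0 < a)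
    (hB : HasDerivBounds E K a) (f : F) {t : ℝ} (ht : 0 < t) :
    DifferentiableOn ℂ (taylorSeries E f t) (Metric.ball (t : ℂ) ((2 * a)⁻¹ * t)) := by
  refine Complex.differentiableOn_tsum_of_summable_norm (summable_bound (K * ‖f‖)) (fun n => ?_)
    Metric.isOpen_ball fun n z hz => norm_taylorTerm_le ha hB f ht n (mem_ball_iff_norm.1 hz).le
  unfold taylorTerm
  fun_prop

theorem taylorSeries_ofReal [CompleteSpace F] (hE : IsC0Semigroup E) (hS : IsSmoothing E) {K a : ℝ}
    (hK : 0 ≤ K) (ha : 0 < a) (hB : HasDerivBounds E K a) (f : F) {t h : ℝ} (ht : 0 < t)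
    (hh : 0 ≤ h) (hlt : h ≤ (2 * a)⁻¹ * t) :
    taylorSeries E f t ((t + h : ℝ) : ℂ) = E (t + h) f := by
  have hz : ‖((t + h : ℝ) : ℂ) - t‖ ≤ (2 * a)⁻¹ * t := by
    rw [← Complex.ofReal_sub, Complex.norm_real, add_sub_cancel_left, Real.norm_of_nonneg hh]
    exact hlt
  have hsum : Summable fun n => taylorTerm E f t n ((t + h : ℝ) : ℂ) :=
    Summable.of_norm_bounded (summable_bound (K * ‖f‖)) fun n => norm_taylorTerm_le ha hB f ht n hz
  have h1 := hsum.hasSum.tendsto_sum_nat.comp (tendsto_add_atTop_nat 1)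
  have hlt' : h * a < t := by
    have : h * a ≤ (2 * a)⁻¹ * t * a := by gcongr
    have e : (2 * a)⁻¹ * t * a = t / 2 := by field_simp
    linarith
  have h2 := hE.tendsto_taylorSum hS hK ha.le hB ht hh hlt' f
  rw [add_comm h t] at h2
  refine tendsto_nhds_unique h1 (h2.congr fun N => ?_)
  refine Finset.sum_congr rfl fun n _ => ?_
  rw [taylorTerm]
  congr 1
  push_cast
  rw [add_sub_cancel_left]

/-- Two Taylor series of an orbit agree where both discs of convergence overlap. -/
theorem taylorSeries_eq [CompleteSpace F] (hE : IsC0Semigroup E) (hS : IsSmoothing E) {K a : ℝ}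
    (hK : 0 ≤ K) (ha : 0 < a) (hB : HasDerivBounds E K a) (f : F) {t₀ t₁ : ℝ} (h₀ : 0 < t₀)
    (h₁ : 0 < t₁) (h₀₁ : t₁ - t₀ < (2 * a)⁻¹ * t₀) (h₁₀ : t₀ - t₁ < (2 * a)⁻¹ * t₁) {z : ℂ}
    (hz₀ : z ∈ Metric.ball (t₀ : ℂ) ((2 * a)⁻¹ * t₀))
    (hz₁ : z ∈ Metric.ball (t₁ : ℂ) ((2 * a)⁻¹ * t₁)) :
    taylorSeries E f t₀ z = taylorSeries E f t₁ z := by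
  set r := (2 * a)⁻¹ with hr
  have hr0 : 0 < r := by positivity
  set D := Metric.ball (t₀ : ℂ) (r * t₀) ∩ Metric.ball (t₁ : ℂ) (r * t₁) with hD
  have hDo : IsOpen D := Metric.isOpen_ball.inter Metric.isOpen_ball
  have a₀ : AnalyticOnNhd ℂ (taylorSeries E f t₀) D :=
    ((differentiableOn_taylorSeries ha hB f h₀).mono inter_subset_left).analyticOnNhd hDo
  have a₁ : AnalyticOnNhd ℂ (taylorSeries E f t₁) D :=
    ((differentiableOn_taylorSeries ha hB f h₁).mono inter_subset_right).analyticOnNhd hDo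
  have hc : IsPreconnected D :=
    ((convex_ball _ _).inter (convex_ball _ _)).isPreconnected
  set m := max t₀ t₁ with hm
  have hm0 : m - t₀ < r * t₀ := by
    have : 0 < r * t₀ := by positivity
    rcases max_cases t₀ t₁ with ⟨h, _⟩ | ⟨h, _⟩ <;> rw [hm, h] <;> linarith
  have hm1 : m - t₁ < r * t₁ := by
    have : 0 < r * t₁ := by positivity
    rcases max_cases t₀ t₁ with ⟨h, _⟩ | ⟨h, _⟩ <;> rw [hm, h] <;> linarith
  have l₀ : t₀ ≤ m := le_max_left _ _
  have l₁ : t₁ ≤ m := le_max_right _ _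
  have hmD : (m : ℂ) ∈ D := by
    refine ⟨?_, ?_⟩ <;> rw [mem_ball_iff_norm, ← Complex.ofReal_sub, Complex.norm_real,
      Real.norm_of_nonneg (by linarith)] <;> assumption
  refine a₀.eqOn_of_preconnected_of_frequently_eq a₁ hc hmD ?_ ⟨hz₀, hz₁⟩
  have ht : Tendsto (fun ε : ℝ => ((m + ε : ℝ) : ℂ)) (𝓝[>] 0) (𝓝[≠] (m : ℂ)) := by
    refine tendsto_nhdsWithin_iff.2 ⟨?_, ?_⟩
    · have : Continuous fun ε : ℝ => ((m + ε : ℝ) : ℂ) := by fun_prop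
      simpa using (this.tendsto 0).mono_left (nhdsWithin_le_nhds (s := Ioi 0))
    · filter_upwards [self_mem_nhdsWithin] with ε hε
      have : m + ε ≠ m := by simpa using (ne_of_gt hε : ε ≠ 0)
      exact mem_compl_singleton_iff.2 (by exact_mod_cast this)
  refine ht.frequently (Eventually.frequently ?_)
  have e₀ := Ioo_mem_nhdsGT (show (0 : ℝ) < r * t₀ - (m - t₀) by linarith)
  have e₁ := Ioo_mem_nhdsGT (show (0 : ℝ) < r * t₁ - (m - t₁) by linarith)
  filter_upwards [e₀, e₁] with ε h2 h3
  have k₀ := hE.taylorSeries_ofReal hS hK ha hB f h₀ (h := m + ε - t₀) (by linarith [h2.1])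
    (by linarith [h2.2])
  have k₁ := hE.taylorSeries_ofReal hS hK ha hB f h₁ (h := m + ε - t₁) (by linarith [h2.1])
    (by linarith [h3.2])
  rw [add_sub_cancel] at k₀ k₁
  rw [k₀, k₁]

theorem hasAnalyticOrbits [CompleteSpace F] (hE : IsC0Semigroup E) (hS : IsSmoothing E) {K a : ℝ}
    (hK : 0 ≤ K) (ha : 0 < a) (hB : HasDerivBounds E K a) : HasAnalyticOrbits E := by
  set r := (2 * a)⁻¹ with hr
  have hr0 : 0 < r := by positivity
  have hmem : ∀ z ∈ posSector (Real.arctan r), 0 < z.re ∧ |z.im| < r * z.re := fun z hz => by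
    rwa [mem_posSector_iff (Real.arctan_pos.2 hr0) (Real.arctan_lt_pi_div_two r),
      Real.tan_arctan] at hz
  refine ⟨Real.arctan r, Real.arctan_pos.2 hr0, Real.arctan_lt_pi_div_two r, fun f =>
    ⟨fun z => taylorSeries E f z.re z, ?_, ?_,
      ∑' n : ℕ, K * ‖f‖ * (((n : ℝ) + 1) * (1 / 2) ^ n), ?_⟩⟩
  · intro z₀ hz₀
    obtain ⟨hre, him⟩ := hmem _ hz₀
    have hball : ∀ z : ℂ, |z.im| < r * z.re → z ∈ Metric.ball ((z.re : ℝ) : ℂ) (r * z.re) := by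
      intro z hz
      have : z - z.re = z.im * Complex.I := by
        rw [sub_eq_iff_eq_add']; exact (Complex.re_add_im z).symm
      rw [mem_ball_iff_norm, this]
      simpa using hz
    have hb := hball z₀ him
    have hd := (differentiableOn_taylorSeries ha hB f hre).differentiableAt
      (Metric.isOpen_ball.mem_nhds hb)
    refine (hd.congr_of_eventuallyEq ?_).differentiableWithinAt
    have n1 : {z : ℂ | 0 < z.re} ∈ 𝓝 z₀ :=
      (isOpen_lt continuous_const Complex.continuous_re).mem_nhds hre
    have n2 : {z : ℂ | |z.im| < r * z.re} ∈ 𝓝 z₀ :=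
      (isOpen_lt (by fun_prop) (by fun_prop)).mem_nhds him
    have n3 : {z : ℂ | z.re - z₀.re < r * z₀.re} ∈ 𝓝 z₀ :=
      (isOpen_lt (by fun_prop) (by fun_prop)).mem_nhds (by simpa using mul_pos hr0 hre)
    have n4 : {z : ℂ | z₀.re - z.re < r * z.re} ∈ 𝓝 z₀ :=
      (isOpen_lt (by fun_prop) (by fun_prop)).mem_nhds (by simpa using mul_pos hr0 hre)
    filter_upwards [n1, n2, n3, n4, Metric.isOpen_ball.mem_nhds hb] with z h1 h2 h3 h4 h5
    exact (hE.taylorSeries_eq hS hK ha hB f hre h1 h3 h4 h5 (hball z h2)).symm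
  · intro t ht
    have := hE.taylorSeries_ofReal hS hK ha hB f ht le_rfl (by positivity)
    simpa using this
  · intro z hz
    obtain ⟨hre, him⟩ := hmem _ hz
    have : z - z.re = z.im * Complex.I := by
      rw [sub_eq_iff_eq_add']; exact (Complex.re_add_im z).symm
    refine tsum_of_norm_bounded (summable_bound (K * ‖f‖)).hasSum fun n =>
      norm_taylorTerm_le ha hB f hre n ?_
    rw [this, norm_mul, Complex.norm_I, mul_one, Complex.norm_real]
    exact him.le

/-- A sectorial generator gives a smoothing semigroup with bounds on all powers of the generator. -/
theorem smoothing_of_sectorialBound [CompleteSpace F] [Nontrivial F] (hE : IsC0Semigroup E)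
    {δ C : ℝ} (hδ : 0 < δ) (h : SectorialBound (generator E) δ C) :
    1 ≤ C ∧ IsSmoothing E ∧ HasDerivBounds E (C ^ 2 * Real.pi * Real.exp 1) (C + 1) := by
  obtain ⟨R, hR⟩ := h.exists_resolvent hδ
  have h1 := hE.one_le_of_resolventFamily hR
  have hC : 0 ≤ C := by linarith
  have hS : IsSmoothing E := fun t ht f => hE.exists_hasGenerator_apply hC hR ht f
  exact ⟨h1, hS, hE.hasDerivBounds hC hR hS⟩

theorem hasAnalyticOrbits_of_sectorialBound [CompleteSpace F] (hE : IsC0Semigroup E) {δ C : ℝ}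
    (hδ : 0 < δ) (h : SectorialBound (generator E) δ C) : HasAnalyticOrbits E := by
  rcases subsingleton_or_nontrivial F with hF | hF
  · exact ⟨1, one_pos, by linarith [Real.pi_gt_three], fun f => ⟨fun _ => 0,
      differentiableOn_const _, fun t _ => Subsingleton.elim _ _, 0, fun z _ => by simp⟩⟩
  · obtain ⟨h1, hS, hB⟩ := hE.smoothing_of_sectorialBound hδ h
    exact hE.hasAnalyticOrbits hS (by have := Real.pi_pos; positivity) (by linarith) hB

theorem mem_domInfty_and_tendsto [CompleteSpace F] (hE : IsC0Semigroup E) {δ C : ℝ}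
    (hδ : 0 < δ) (h : SectorialBound (generator E) δ C) {τ : ℝ} (hτ : 0 < τ) (g : F) :
    E τ g ∈ domInfty (generator E) ∧ ∀ t : ℝ, 0 ≤ t → t < τ / (C * Real.exp 1) →
      Tendsto (fun M : ℕ => ‖E t (E τ g) - taylorSum (generator E) (E τ g) M t‖) atTop (𝓝 0) := by
  rcases subsingleton_or_nontrivial F with hF | hF
  · refine ⟨fun m => ?_, fun t _ _ => ?_⟩
    · rw [Subsingleton.elim (genPow (generator E) m (E τ g)) 0]
      exact zero_mem _
    · simp [Subsingleton.elim _ (0 : F)]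
  · obtain ⟨h1, hS, hB⟩ := hE.smoothing_of_sectorialBound hδ h
    refine ⟨fun m => (hE.hasGenerator_genPow hS m hτ g).mem_domain, fun t ht0 ht => ?_⟩
    have he : 2 < Real.exp 1 := by linarith [Real.exp_one_gt_d9]
    rw [lt_div_iff₀ (by positivity)] at ht
    have hlt : t * (C + 1) < τ := by
      refine lt_of_le_of_lt ?_ ht
      gcongr
      nlinarith
    have := hE.tendsto_taylorSum hS (by have := Real.pi_pos; positivity) (by linarith) hB hτ ht0
      hlt g
    rw [hE.apply_add ht0 hτ.le, tendsto_iff_norm_sub_tendsto_zero] at this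
    simpa only [norm_sub_rev] using this

end IsC0Semigroup

theorem HasAnalyticOrbits.analyticAt {F : Type*} [NormedAddCommGroup F] [NormedSpace ℂ F]
    [CompleteSpace F] {E : ℝ → F →L[ℂ] F} (h : HasAnalyticOrbits E) (f : F) {t : ℝ} (ht : 0 < t) :
    AnalyticAt ℝ (fun s : ℝ => E s f) t := by
  obtain ⟨θ, hθ, hθ', hU⟩ := h
  obtain ⟨U, hU1, hU2, -⟩ := hU f
  have h1 : AnalyticAt ℂ U (t : ℂ) :=
    hU1.analyticAt ((isOpen_posSector hθ').mem_nhds (ofReal_mem_posSector hθ ht))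
  have h2 : AnalyticAt ℝ (fun s : ℝ => U (s : ℂ)) t :=
    h1.restrictScalars.comp (Complex.ofRealCLM.analyticAt t)
  refine h2.congr ?_
  filter_upwards [Ioi_mem_nhds ht] with s hs
  exact hU2 s hs

theorem add_mem_posSector {θ : ℝ} (hθ : 0 < θ) (hθ' : θ < Real.pi / 2) {z w : ℂ}
    (hz : z ∈ posSector θ) (hw : w ∈ posSector θ) : z + w ∈ posSector θ := by
  rw [mem_posSector_iff hθ hθ'] at *
  refine ⟨add_pos hz.1 hw.1, ?_⟩
  rw [Complex.add_im, Complex.add_re, mul_add]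
  exact (abs_add_le _ _).trans_lt (add_lt_add hz.2 hw.2)

theorem add_ofReal_mem_posSector {θ : ℝ} (hθ : 0 < θ) (hθ' : θ < Real.pi / 2) {z : ℂ}
    (hz : z ∈ posSector θ) {s : ℝ} (hs : 0 ≤ s) : z + s ∈ posSector θ := by
  rcases hs.eq_or_lt with rfl | hs
  · simpa using hz
  · exact add_mem_posSector hθ hθ' hz (ofReal_mem_posSector hθ hs)

theorem mul_ofReal_mem_posSector {θ : ℝ} (hθ : 0 < θ) (hθ' : θ < Real.pi / 2) {z : ℂ}
    (hz : z ∈ posSector θ) {t : ℝ} (ht : 0 < t) : z * t ∈ posSector θ := by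
  rw [mem_posSector_iff hθ hθ'] at *
  simp only [Complex.mul_re, Complex.mul_im, Complex.ofReal_re, Complex.ofReal_im, mul_zero,
    sub_zero, zero_add]
  refine ⟨mul_pos hz.1 ht, ?_⟩
  rw [abs_mul, abs_of_pos ht, ← mul_assoc]
  exact mul_lt_mul_of_pos_right hz.2 ht

theorem isPreconnected_posSector {θ : ℝ} (hθ : 0 < θ) (hθ' : θ < Real.pi / 2) :
    IsPreconnected (posSector θ) := by
  refine Convex.isPreconnected fun z hz w hw a b ha hb hab => ?_
  rcases ha.eq_or_lt with rfl | ha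
  · rw [zero_add] at hab
    simpa [hab] using hw
  rcases hb.eq_or_lt with rfl | hb
  · rw [add_zero] at hab
    simpa [hab] using hz
  have h1 := mul_ofReal_mem_posSector hθ hθ' hz ha
  have h2 := mul_ofReal_mem_posSector hθ hθ' hw hb
  have := add_mem_posSector hθ hθ' h1 h2
  rw [Complex.real_smul, Complex.real_smul, mul_comm, mul_comm (b : ℂ)]
  exact this

section

variable {F : Type*} [NormedAddCommGroup F] [NormedSpace ℂ F]

/-- Holomorphic functions on a sector are determined by their values on the positive half-line. -/
theorem eqOn_posSector [CompleteSpace F] {θ : ℝ} (hθ : 0 < θ) (hθ' : θ < Real.pi / 2)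
    {V W : ℂ → F} (hV : DifferentiableOn ℂ V (posSector θ))
    (hW : DifferentiableOn ℂ W (posSector θ)) (h : ∀ t : ℝ, 0 < t → V t = W t) :
    EqOn V W (posSector θ) := by
  have ho := isOpen_posSector hθ'
  refine (hV.analyticOnNhd ho).eqOn_of_preconnected_of_frequently_eq (hW.analyticOnNhd ho)
    (isPreconnected_posSector hθ hθ') (ofReal_mem_posSector hθ one_pos) ?_
  have ht : Tendsto (fun ε : ℝ => ((1 + ε : ℝ) : ℂ)) (𝓝[>] 0) (𝓝[≠] ((1 : ℝ) : ℂ)) := by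
    refine tendsto_nhdsWithin_iff.2 ⟨?_, ?_⟩
    · have : Continuous fun ε : ℝ => ((1 + ε : ℝ) : ℂ) := by fun_prop
      simpa using (this.tendsto 0).mono_left (nhdsWithin_le_nhds (s := Ioi 0))
    · filter_upwards [self_mem_nhdsWithin] with ε hε
      have : 1 + ε ≠ 1 := by simpa using (ne_of_gt hε : ε ≠ 0)
      exact mem_compl_singleton_iff.2 (by exact_mod_cast this)
  refine ht.frequently (Eventually.frequently ?_)
  filter_upwards [self_mem_nhdsWithin] with ε hε
  exact h _ (by have := mem_Ioi.1 hε; linarith)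

/-- `U f` is a holomorphic extension of the orbit of `f` to the sector of half-angle `θ`, bounded
by `K ‖f‖`. -/
structure IsSectorialExtension (E : ℝ → F →L[ℂ] F) (θ K : ℝ) (U : F → ℂ → F) : Prop where
  pos : 0 < θ
  lt : θ < Real.pi / 2
  differentiableOn : ∀ f, DifferentiableOn ℂ (U f) (posSector θ)
  apply_ofReal : ∀ (f : F) (t : ℝ), 0 < t → U f t = E t f
  bound_nonneg : 0 ≤ K
  norm_le : ∀ (f : F), ∀ z ∈ posSector θ, ‖U f z‖ ≤ K * ‖f‖

open BoundedContinuousFunction in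
/-- The closed graph theorem makes the bounds on the extended orbits uniform. -/
theorem HasAnalyticOrbits.exists_isSectorialExtension [CompleteSpace F] {E : ℝ → F →L[ℂ] F}
    (h : HasAnalyticOrbits E) : ∃ (θ K : ℝ) (U : F → ℂ → F), IsSectorialExtension E θ K U := by
  obtain ⟨θ, hθ, hθ', hU⟩ := h
  choose U hU1 hU2 K hK using hU
  have huniq : ∀ (f : F) (V : ℂ → F), DifferentiableOn ℂ V (posSector θ) →
      (∀ t : ℝ, 0 < t → V t = E t f) → EqOn V (U f) (posSector θ) := fun f V hV h =>
    eqOn_posSector hθ hθ' hV (hU1 f) fun t ht => by rw [h t ht, hU2 f t ht]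
  have hadd : ∀ f g, EqOn (U f + U g) (U (f + g)) (posSector θ) := fun f g =>
    huniq _ _ ((hU1 f).add (hU1 g)) fun t ht => by simp [hU2 _ t ht]
  have hsmul : ∀ (c : ℂ) f, EqOn (c • U f) (U (c • f)) (posSector θ) := fun c f =>
    huniq _ _ ((hU1 f).const_smul c) fun t ht => by simp [hU2 _ t ht]
  let T : F →ₗ[ℂ] (posSector θ →ᵇ F) :=
    { toFun := fun f => ofNormedAddCommGroup (fun z : posSector θ => U f z)
        (continuousOn_iff_continuous_domRestrict.1 (hU1 f).continuousOn) (K f) fun z => hK f z z.2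
      map_add' := fun f g => by
        ext z
        exact (hadd f g z.2).symm
      map_smul' := fun c f => by
        ext z
        exact (hsmul c f z.2).symm }
  have hT : ∀ f (z : posSector θ), T f z = U f z := fun f z => rfl
  have hcont : Continuous T := by
    refine T.continuous_of_seq_closed_graph fun u x y hu hy => ?_
    classical
    let V : ℂ → F := fun z => if hz : z ∈ posSector θ then y ⟨z, hz⟩ else 0
    have hV : ∀ z (hz : z ∈ posSector θ), V z = y ⟨z, hz⟩ := fun z hz => dif_pos hz
    have hlim : TendstoUniformlyOn (fun n => U (u n)) V atTop (posSector θ) := by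
      rw [Metric.tendstoUniformlyOn_iff]
      intro ε hε
      filter_upwards [(Metric.tendsto_nhds.1 hy) ε hε] with n hn z hz
      rw [hV z hz, dist_comm]
      exact (dist_coe_le_dist (f := T (u n)) (g := y) ⟨z, hz⟩).trans_lt hn
    have hVd : DifferentiableOn ℂ V (posSector θ) :=
      hlim.tendstoLocallyUniformlyOn.differentiableOn (Eventually.of_forall fun n => hU1 (u n))
        (isOpen_posSector hθ')
    have hVt : ∀ t : ℝ, 0 < t → V t = E t x := fun t ht => by
      have h1 := hlim.tendsto_at (ofReal_mem_posSector hθ ht)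
      have h2 := ((E t).continuous.tendsto x).comp hu
      refine tendsto_nhds_unique h1 (h2.congr fun n => ?_)
      exact (hU2 (u n) t ht).symm
    ext z
    rw [hT, ← huniq x V hVd hVt z.2, hV z z.2]
  let T' : F →L[ℂ] (posSector θ →ᵇ F) := ⟨T, hcont⟩
  refine ⟨θ, ‖T'‖, U, hθ, hθ', hU1, hU2, norm_nonneg _, fun f z hz => ?_⟩
  exact ((T' f).norm_coe_le_norm ⟨z, hz⟩).trans (T'.le_opNorm f)

end

namespace IsSectorialExtension

open IsC0Semigroup

variable {F : Type*} [NormedAddCommGroup F] [NormedSpace ℂ F]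
  {E : ℝ → F →L[ℂ] F} {θ K : ℝ} {U : F → ℂ → F}

theorem eqOn [CompleteSpace F]
    (hU : IsSectorialExtension E θ K U) {f : F} {V : ℂ → F}
    (hV : DifferentiableOn ℂ V (posSector θ)) (h : ∀ t : ℝ, 0 < t → V t = E t f) :
    EqOn V (U f) (posSector θ) :=
  eqOn_posSector hU.pos hU.lt hV (hU.differentiableOn f) fun t ht => by
    rw [h t ht, hU.apply_ofReal f t ht]

theorem map_sub [CompleteSpace F]
    (hU : IsSectorialExtension E θ K U) (f g : F) {z : ℂ} (hz : z ∈ posSector θ) :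
    U (f - g) z = U f z - U g z :=
  (hU.eqOn (f := f - g) ((hU.differentiableOn f).sub (hU.differentiableOn g))
    (fun t ht => by simp [hU.apply_ofReal _ t ht]) hz).symm

theorem differentiableOn_add (hU : IsSectorialExtension E θ K U) (f : F) {s : ℝ} (hs : 0 ≤ s) :
    DifferentiableOn ℂ (fun z => U f (z + s)) (posSector θ) :=
  (hU.differentiableOn f).comp (differentiableOn_id.add_const (s : ℂ)) fun _ hz =>
    add_ofReal_mem_posSector hU.pos hU.lt hz hs

theorem apply_add [CompleteSpace F]
    (hU : IsSectorialExtension E θ K U) (hE : IsC0Semigroup E) (f : F) {s : ℝ}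
    (hs : 0 ≤ s) {z : ℂ} (hz : z ∈ posSector θ) : U (E s f) z = U f (z + s) := by
  refine (hU.eqOn (f := E s f) (hU.differentiableOn_add f hs) (fun t ht => ?_) hz).symm
  rw [← Complex.ofReal_add, hU.apply_ofReal f _ (by linarith), hE.apply_add ht.le hs]

theorem semigroup_apply [CompleteSpace F]
    (hU : IsSectorialExtension E θ K U) (hE : IsC0Semigroup E) (f : F) {s : ℝ}
    (hs : 0 ≤ s) {z : ℂ} (hz : z ∈ posSector θ) : E s (U f z) = U f (z + s) := by
  refine eqOn_posSector hU.pos hU.lt (V := fun z => E s (U f z))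
    ((E s).differentiable.comp_differentiableOn (hU.differentiableOn f))
    (hU.differentiableOn_add f hs) (fun t ht => ?_) hz
  rw [← Complex.ofReal_add, hU.apply_ofReal f t ht, hU.apply_ofReal f (t + s) (by linarith),
    add_comm, hE.apply_add hs ht.le]

theorem apply_of_eigenvector [CompleteSpace F]
    (hU : IsSectorialExtension E θ K U) (hE : IsC0Semigroup E) {f : F}
    {ξ : ℂ} (h : HasGenerator E f (ξ • f)) {z : ℂ} (hz : z ∈ posSector θ) :
    U f z = Complex.exp (ξ * z) • f := by
  refine (hU.eqOn (V := fun z => Complex.exp (ξ * z) • f) (f := f) (by fun_prop)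
    (fun t ht => ?_) hz).symm
  have h1 : ∀ x ∈ Icc 0 t, weight 0 ξ x • E x f = weight 0 ξ 0 • E 0 f := by
    refine constant_of_has_deriv_right_zero
      (((continuous_weight 0 ξ).continuousOn).smul ((hE.continuousOn f).mono fun x hx => hx.1))
      fun x hx => ?_
    refine (((hasDerivAt_weight_zero ξ x).hasDerivWithinAt).smul
      (hasDerivWithinAt_Ioi_iff_Ici.1 (hE.hasDerivWithinAt_right h hx.1))).congr_deriv ?_
    rw [_root_.map_smul, smul_smul, neg_smul, mul_comm ξ]
    abel
  have h2 := h1 t ⟨ht.le, le_rfl⟩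
  rw [hE.apply_zero] at h2
  simp only [weight, pow_zero, one_mul, Complex.ofReal_zero, mul_zero, neg_zero, Complex.exp_zero,
    one_smul] at h2
  calc Complex.exp (ξ * t) • f = Complex.exp (ξ * t) • Complex.exp (-(ξ * t)) • E t f := by rw [h2]
    _ = E t f := by rw [smul_smul, ← Complex.exp_add, add_neg_cancel, Complex.exp_zero, one_smul]

/-- Eigenvectors grow along some ray of the sector, unless they vanish. -/
theorem eq_zero_of_eigenvector [CompleteSpace F]
    (hU : IsSectorialExtension E θ K U) (hE : IsC0Semigroup E) {f : F}
    {ξ w : ℂ} (hw : w ∈ posSector θ) (hξ : 0 < (ξ * w).re) (h : HasGenerator E f (ξ • f)) :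
    f = 0 := by
  by_contra hf
  have hf' : 0 < ‖f‖ := norm_pos_iff.2 hf
  have h1 : ∀ t : ℝ, 0 < t → Real.exp ((ξ * w).re * t) ≤ K := by
    intro t ht
    have hm := mul_ofReal_mem_posSector hU.pos hU.lt hw ht
    have h2 := hU.norm_le f _ hm
    rw [hU.apply_of_eigenvector hE h hm, norm_smul, Complex.norm_exp, ← mul_assoc,
      Complex.re_mul_ofReal] at h2
    exact le_of_mul_le_mul_right h2 hf'
  have h3 : Tendsto (fun t : ℝ => Real.exp ((ξ * w).re * t)) atTop atTop :=
    Real.tendsto_exp_atTop.comp (tendsto_id.const_mul_atTop hξ)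
  obtain ⟨t, ht, ht0⟩ := ((h3.eventually_gt_atTop K).and (eventually_gt_atTop 0)).exists
  exact absurd (h1 t ht0) (not_le.2 ht)

/-- The Laplace transform along the ray through `w`. -/
noncomputable def rayLaplace (U : F → ℂ → F) (w ξ : ℂ) (f : F) : F :=
  ∫ t in Ioi (0 : ℝ), weight 0 (ξ * w) t • w • U f (w * t)

theorem norm_weight_smul_le_of_bound {η w : ℂ} {L t : ℝ} {v : F} (ht : 0 ≤ t) (hv : ‖v‖ ≤ L) :
    ‖weight 0 η t • w • v‖ ≤ ‖w‖ * L * Real.exp (-η.re * t) := by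
  rw [norm_smul, norm_smul, norm_weight 0 η ht, pow_zero, one_mul, neg_mul]
  calc _ ≤ Real.exp (-(η.re * t)) * (‖w‖ * L) := by gcongr
    _ = _ := by ring

theorem integrableOn_ray [CompleteSpace F] {η w : ℂ} (hη : 0 < η.re) {V : ℝ → F} {L : ℝ}
    (hc : ContinuousOn V (Ioi 0)) (hV : ∀ t : ℝ, 0 < t → ‖V t‖ ≤ L) :
    IntegrableOn (fun t => weight 0 η t • w • V t) (Ioi 0) := by
  refine Integrable.mono'
    ((integrableOn_exp_mul_Ioi (neg_lt_zero.2 hη) 0).const_mul (‖w‖ * L)) ?_ ?_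
  · exact (((continuous_weight 0 η).continuousOn).smul (hc.const_smul w)).aestronglyMeasurable
      measurableSet_Ioi
  · filter_upwards [ae_restrict_mem measurableSet_Ioi] with t ht
    exact norm_weight_smul_le_of_bound (le_of_lt ht) (hV t ht)

theorem continuousOn_ray (hU : IsSectorialExtension E θ K U) {w : ℂ} (hw : w ∈ posSector θ)
    (f : F) : ContinuousOn (fun t : ℝ => U f (w * t)) (Ioi 0) :=
  (hU.differentiableOn f).continuousOn.comp (by fun_prop) fun _ ht =>
    mul_ofReal_mem_posSector hU.pos hU.lt hw ht

theorem norm_ray_le (hU : IsSectorialExtension E θ K U) {w : ℂ} (hw : w ∈ posSector θ)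
    (f : F) (t : ℝ) (ht : 0 < t) : ‖U f (w * t)‖ ≤ K * ‖f‖ :=
  hU.norm_le f _ (mul_ofReal_mem_posSector hU.pos hU.lt hw ht)

theorem norm_rayLaplace_le [CompleteSpace F]
    (hU : IsSectorialExtension E θ K U) {w ξ : ℂ} (hw : w ∈ posSector θ)
    (hξ : 0 < (ξ * w).re) (f : F) :
    ‖rayLaplace U w ξ f‖ ≤ ‖w‖ * K / (ξ * w).re * ‖f‖ := by
  refine (norm_integral_le_of_norm_le
    ((integrableOn_exp_mul_Ioi (neg_lt_zero.2 hξ) 0).const_mul (‖w‖ * (K * ‖f‖))) ?_).trans_eq ?_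
  · filter_upwards [ae_restrict_mem measurableSet_Ioi] with t ht
    exact norm_weight_smul_le_of_bound (le_of_lt ht) (hU.norm_ray_le hw f t ht)
  · rw [integral_const_mul, integral_exp_mul_Ioi (neg_lt_zero.2 hξ)]
    simp only [mul_zero, Real.exp_zero, neg_div_neg_eq]
    ring

theorem rayLaplace_sub [CompleteSpace F]
    (hU : IsSectorialExtension E θ K U) {w ξ : ℂ} (hw : w ∈ posSector θ)
    (hξ : 0 < (ξ * w).re) (f g : F) :
    rayLaplace U w ξ (f - g) = rayLaplace U w ξ f - rayLaplace U w ξ g := by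
  rw [rayLaplace, rayLaplace, rayLaplace,
    ← integral_sub (integrableOn_ray hξ (hU.continuousOn_ray hw f) (hU.norm_ray_le hw f))
      (integrableOn_ray hξ (hU.continuousOn_ray hw g) (hU.norm_ray_le hw g))]
  refine setIntegral_congr_fun measurableSet_Ioi fun t ht => ?_
  rw [hU.map_sub _ _ (mul_ofReal_mem_posSector hU.pos hU.lt hw ht), smul_sub, smul_sub]

theorem hasDerivAt_comp_line {V : ℂ → F} {c w : ℂ} {x : ℝ} (h : DifferentiableAt ℂ V (c + w * x)) :
    HasDerivAt (fun y : ℝ => V (c + w * y)) (w • deriv V (c + w * x)) x := by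
  have h1 : HasDerivAt (fun y : ℝ => c + w * (y : ℂ)) w x := by
    have := (((hasDerivAt_id (x : ℂ)).const_mul w).const_add c).comp_ofReal
    simpa using this
  exact h.hasDerivAt.scomp x h1

theorem exists_norm_deriv_le (hU : IsSectorialExtension E θ K U) (g : F) {σ : ℝ} (hσ : 0 < σ) :
    ∃ L : ℝ, ∀ p ∈ posSector θ, ‖deriv (U g) (σ + p)‖ ≤ L := by
  obtain ⟨ρ, hρ, hb⟩ := Metric.nhds_basis_closedBall.mem_iff.1
    ((isOpen_posSector hU.lt).mem_nhds (ofReal_mem_posSector hU.pos hσ))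
  refine ⟨K * ‖g‖ / ρ, fun p hp => ?_⟩
  have hsub : Metric.closedBall (σ + p) ρ ⊆ posSector θ := by
    intro z hz
    have h1 : z - p ∈ posSector θ := hb (by
      rw [mem_closedBall_iff_norm] at hz ⊢
      convert hz using 2
      ring)
    have := add_mem_posSector hU.pos hU.lt h1 hp
    rwa [sub_add_cancel] at this
  refine Complex.norm_deriv_le_of_forall_mem_sphere_norm_le hρ ?_ fun z hz =>
    hU.norm_le g z (hsub (Metric.sphere_subset_closedBall hz))
  refine DifferentiableOn.diffContOnCl ?_
  exact (hU.differentiableOn g).mono (Metric.closure_ball_subset_closedBall.trans hsub)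

theorem hasGenerator_rayLaplace_apply [CompleteSpace F]
    (hU : IsSectorialExtension E θ K U) (hE : IsC0Semigroup E)
    {w ξ : ℂ} (hw : w ∈ posSector θ) (hξ : 0 < (ξ * w).re) (g : F) {σ : ℝ} (hσ : 0 < σ) :
    HasGenerator E (rayLaplace U w ξ (E σ g)) (ξ • rayLaplace U w ξ (E σ g) - E σ g) := by
  have ho := isOpen_posSector hU.lt
  have hσ2 : 0 < σ / 2 := by positivity
  obtain ⟨L, hL⟩ := hU.exists_norm_deriv_le g hσ2
  have hL' : ∀ t x : ℝ, 0 ≤ t → -(σ / 2) < x → ‖deriv (U g) ((σ + w * t) + x)‖ ≤ L ∧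
      (σ + w * t) + x ∈ posSector θ := by
    intro t x ht hx
    have e : (σ + w * t : ℂ) + x = (σ / 2 : ℝ) + ((σ / 2 + x : ℝ) + w * t) := by push_cast; ring
    have hm : ((σ / 2 + x : ℝ) + w * t : ℂ) ∈ posSector θ := by
      have h1 := ofReal_mem_posSector hU.pos (show 0 < σ / 2 + x by linarith)
      rcases ht.eq_or_lt with rfl | ht
      · simpa using h1
      · exact add_mem_posSector hU.pos hU.lt h1 (mul_ofReal_mem_posSector hU.pos hU.lt hw ht)
    rw [e]
    exact ⟨hL _ hm, add_mem_posSector hU.pos hU.lt (ofReal_mem_posSector hU.pos hσ2) hm⟩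
  have hd : ∀ t x : ℝ, 0 ≤ t → -(σ / 2) < x → DifferentiableAt ℂ (U g) ((σ + w * t) + x) :=
    fun t x ht hx => (hU.differentiableOn g).differentiableAt (ho.mem_nhds (hL' t x ht hx).2)
  have hcd : ContinuousOn (deriv (U g)) (posSector θ) :=
    ((hU.differentiableOn g).deriv ho).continuousOn
  have hmaps : ∀ x : ℝ, -(σ / 2) < x → MapsTo (fun t : ℝ => (σ + w * t : ℂ) + x) (Ioi 0)
      (posSector θ) := fun x hx t ht => (hL' t x (le_of_lt ht) hx).2
  have hcx : ∀ x : ℝ, -(σ / 2) < x →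
      ContinuousOn (fun t : ℝ => U g ((σ + w * t) + x)) (Ioi 0) := fun x hx =>
    (hU.differentiableOn g).continuousOn.comp (by fun_prop) (hmaps x hx)
  have hbx : ∀ x : ℝ, -(σ / 2) < x → ∀ t : ℝ, 0 < t → ‖U g ((σ + w * t) + x)‖ ≤ K * ‖g‖ :=
    fun x hx t ht => hU.norm_le g _ (hmaps x hx ht)
  have h0 : -(σ / 2) < (0 : ℝ) := by linarith
  set H : ℝ → F := fun x => ∫ t in Ioi (0 : ℝ), weight 0 (ξ * w) t • w • U g ((σ + w * t) + x)
    with hH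
  have hHE : ∀ x : ℝ, 0 ≤ x → E x (rayLaplace U w ξ (E σ g)) = H x := by
    intro x hx
    rw [rayLaplace, ← ContinuousLinearMap.integral_comp_comm _
      (integrableOn_ray hξ (hU.continuousOn_ray hw _) (hU.norm_ray_le hw _))]
    refine setIntegral_congr_fun measurableSet_Ioi fun t ht => ?_
    have hm := mul_ofReal_mem_posSector hU.pos hU.lt hw ht
    simp only [_root_.map_smul]
    rw [hU.semigroup_apply hE _ hx hm, hU.apply_add hE g hσ.le
      (add_ofReal_mem_posSector hU.pos hU.lt hm hx)]
    congr 3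
    ring
  have hderiv := (hasDerivAt_integral_of_dominated_loc_of_deriv_le
    (𝕜 := ℝ) (μ := volume.restrict (Ioi (0 : ℝ))) (x₀ := (0 : ℝ)) (s := Ioi (-(σ / 2)))
    (F := fun (x t : ℝ) => weight 0 (ξ * w) t • w • U g ((σ + w * t) + x))
    (F' := fun (x t : ℝ) => weight 0 (ξ * w) t • w • deriv (U g) ((σ + w * t) + x))
    (bound := fun t => ‖w‖ * L * Real.exp (-(ξ * w).re * t))
    (Ioi_mem_nhds h0)
    (by
      filter_upwards [Ioi_mem_nhds h0] with x hx
      exact (integrableOn_ray hξ (hcx x hx) (hbx x hx)).aestronglyMeasurable)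
    (integrableOn_ray hξ (hcx 0 h0) (hbx 0 h0))
    (integrableOn_ray hξ (hcd.comp (by fun_prop) (hmaps 0 h0))
      (fun t ht => (hL' t 0 ht.le h0).1)).aestronglyMeasurable
    (by
      filter_upwards [ae_restrict_mem measurableSet_Ioi] with t ht x hx
      exact norm_weight_smul_le_of_bound (le_of_lt ht) (hL' t x (le_of_lt ht) hx).1)
    ((integrableOn_exp_mul_Ioi (neg_lt_zero.2 hξ) 0).const_mul _)
    (by
      filter_upwards [ae_restrict_mem measurableSet_Ioi] with t ht x hx
      have := hasDerivAt_comp_line (V := U g) (c := σ + w * t) (w := 1) (x := x)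
        (by simpa using hd t x (le_of_lt ht) hx)
      simp only [one_mul, one_smul] at this
      exact (this.const_smul w).const_smul (weight 0 (ξ * w) t))).2
  have hgen : HasGenerator E (rayLaplace U w ξ (E σ g))
      (∫ t in Ioi (0 : ℝ), weight 0 (ξ * w) t • w • deriv (U g) ((σ + w * t) + (0 : ℝ))) := by
    have h2 := (hasDerivWithinAt_iff_tendsto_slope' self_notMem_Ioi).1
      (hderiv.hasDerivWithinAt (s := Ioi 0))
    refine h2.congr' ?_
    filter_upwards [self_mem_nhdsWithin] with x hx
    rw [slope, vsub_eq_sub, sub_zero, hHE x (le_of_lt hx), ← Complex.ofReal_inv]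
    have h3 := hHE 0 le_rfl
    rw [hE.apply_zero] at h3
    rw [h3]
    exact (Complex.coe_smul _ _).symm
  convert hgen using 1
  have hφ : ∀ t ∈ Ioi (0 : ℝ), HasDerivAt (fun t : ℝ => weight 0 (ξ * w) t • U g (σ + w * t))
      (weight 0 (ξ * w) t • w • deriv (U g) ((σ + w * t) + (0 : ℝ)) -
        ξ • weight 0 (ξ * w) t • w • U g ((σ + w * t) + (0 : ℝ))) t := by
    intro t ht
    have h1 := hd t 0 (le_of_lt ht) h0
    rw [Complex.ofReal_zero, add_zero] at h1
    refine ((hasDerivAt_weight_zero (ξ * w) t).smul (hasDerivAt_comp_line h1)).congr_deriv ?_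
    rw [Complex.ofReal_zero, add_zero, neg_smul, ← sub_eq_add_neg, smul_smul, smul_smul, smul_smul]
    congr 2
    ring
  have i1 : IntegrableOn (fun t : ℝ => weight 0 (ξ * w) t • w •
      deriv (U g) ((σ + w * t) + (0 : ℝ))) (Ioi 0) :=
    integrableOn_ray (w := w) hξ (hcd.comp (by fun_prop) (hmaps 0 h0))
      (fun t ht => (hL' t 0 ht.le h0).1)
  have i2 : IntegrableOn (fun t : ℝ => ξ • weight 0 (ξ * w) t • w • U g ((σ + w * t) + (0 : ℝ)))
      (Ioi 0) := (integrableOn_ray hξ (hcx 0 h0) (hbx 0 h0)).smul ξ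
  have hc0 : ContinuousWithinAt (fun t : ℝ => weight 0 (ξ * w) t • U g (σ + w * t)) (Ici 0) 0 := by
    have h1 := hd 0 0 le_rfl h0
    rw [Complex.ofReal_zero, add_zero] at h1
    have h2 := (hasDerivAt_comp_line h1).continuousAt
    exact (((continuous_weight 0 (ξ * w)).continuousAt).smul h2).continuousWithinAt
  have hlim : Tendsto (fun t : ℝ => weight 0 (ξ * w) t • U g (σ + w * t)) atTop (𝓝 0) := by
    have h1 : Tendsto (fun t : ℝ => K * ‖g‖ * Real.exp (-((ξ * w).re * t))) atTop (𝓝 0) := by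
      have := (Real.tendsto_exp_neg_atTop_nhds_zero.comp
        (tendsto_id.const_mul_atTop hξ)).const_mul (K * ‖g‖)
      simpa using this
    refine squeeze_zero_norm' ?_ h1
    filter_upwards [eventually_gt_atTop 0] with t ht
    have h3 := hbx 0 h0 t ht
    rw [Complex.ofReal_zero, add_zero] at h3
    rw [norm_smul, norm_weight 0 _ ht.le, pow_zero, one_mul, mul_comm]
    gcongr
  have hint := integral_Ioi_of_hasDerivAt_of_tendsto hc0 hφ (i1.sub i2) hlim
  rw [integral_sub i1 i2, integral_smul] at hint
  have h3 := hHE 0 le_rfl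
  rw [hE.apply_zero] at h3
  rw [h3, hH]
  simp only [weight, pow_zero, one_mul, Complex.ofReal_zero, mul_zero, neg_zero, Complex.exp_zero,
    one_smul, add_zero, zero_sub] at hint ⊢
  rw [hU.apply_ofReal g σ hσ] at hint
  rw [sub_eq_iff_eq_add.1 hint]
  abel

/-- The Laplace transform along a ray is a right inverse of `ξ - B`. -/
theorem hasGenerator_rayLaplace [CompleteSpace F]
    (hU : IsSectorialExtension E θ K U) (hE : IsC0Semigroup E)
    {w ξ : ℂ} (hw : w ∈ posSector θ) (hξ : 0 < (ξ * w).re) (f : F) :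
    HasGenerator E (rayLaplace U w ξ f) (ξ • rayLaplace U w ξ f - f) := by
  have h1 : Tendsto (fun σ => E σ f) (𝓝[>] 0) (𝓝 f) := hE.continuous_zero f
  have h2 : Tendsto (fun σ => rayLaplace U w ξ (E σ f)) (𝓝[>] 0) (𝓝 (rayLaplace U w ξ f)) := by
    rw [tendsto_iff_norm_sub_tendsto_zero] at h1 ⊢
    have h3 := h1.const_mul (‖w‖ * K / (ξ * w).re)
    rw [mul_zero] at h3
    refine squeeze_zero (fun _ => norm_nonneg _) (fun σ => ?_) h3
    rw [← hU.rayLaplace_sub hw hξ]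
    exact hU.norm_rayLaplace_le hw hξ _
  refine hE.hasGenerator_of_tendsto ?_ h2 ((h2.const_smul ξ).sub h1)
  filter_upwards [self_mem_nhdsWithin] with σ hσ
  exact hU.hasGenerator_rayLaplace_apply hE hw hξ f hσ

theorem exists_direction (hθ : 0 < θ) (hθ' : θ < Real.pi / 2) {ξ : ℂ}
    (hξ : |ξ.arg| ≤ Real.pi / 2 + θ / 4) :
    ∃ w ∈ posSector θ, ‖w‖ = 1 ∧ ‖ξ‖ * Real.sin (θ / 4) ≤ (ξ * w).re := by
  have key : ∀ φ : ℝ, |φ| < θ → |ξ.arg + φ| ≤ Real.pi / 2 - θ / 4 →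
      ∃ w ∈ posSector θ, ‖w‖ = 1 ∧ ‖ξ‖ * Real.sin (θ / 4) ≤ (ξ * w).re := by
    intro φ h1 h2
    refine ⟨Complex.exp (φ * Complex.I), ⟨Complex.exp_ne_zero _, ?_⟩,
      Complex.norm_exp_ofReal_mul_I φ, ?_⟩
    · rw [Complex.exp_mul_I, Complex.arg_cos_add_sin_mul_I]
      · exact h1
      · have := abs_lt.1 h1
        constructor <;> linarith
    · have e : ξ * Complex.exp (φ * Complex.I) =
          ‖ξ‖ * Complex.exp ((ξ.arg + φ : ℝ) * Complex.I) := by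
        conv_lhs => rw [← Complex.norm_mul_exp_arg_mul_I ξ]
        rw [mul_assoc, ← Complex.exp_add]
        congr 2
        push_cast
        ring
      rw [e, Complex.re_ofReal_mul, Complex.exp_ofReal_mul_I_re]
      refine mul_le_mul_of_nonneg_left ?_ (norm_nonneg _)
      rw [← Real.cos_pi_div_two_sub, ← Real.cos_abs (ξ.arg + φ)]
      exact Real.cos_le_cos_of_nonneg_of_le_pi (abs_nonneg _) (by linarith) h2
  have h3 := abs_le.1 hξ
  rcases le_total 0 ξ.arg with h | h
  · refine key (-(θ / 2)) (by rw [abs_neg, abs_of_pos] <;> linarith) (abs_le.2 ⟨?_, ?_⟩) <;>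
      linarith
  · refine key (θ / 2) (by rw [abs_of_pos] <;> linarith) (abs_le.2 ⟨?_, ?_⟩) <;> linarith

theorem sectorialBound [CompleteSpace F]
    (hU : IsSectorialExtension E θ K U) (hE : IsC0Semigroup E) :
    SectorialBound (generator E) (θ / 4) (K / Real.sin (θ / 4)) := by
  have hs : 0 < Real.sin (θ / 4) :=
    Real.sin_pos_of_pos_of_lt_pi (by linarith [hU.pos]) (by linarith [hU.lt, hU.pos])
  have hdir : ∀ ξ : ℂ, ξ ≠ 0 → ξ ∉ negSector (θ / 4) →
      ∃ w ∈ posSector θ, ‖w‖ = 1 ∧ ‖ξ‖ * Real.sin (θ / 4) ≤ (ξ * w).re := fun ξ h0 hn =>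
    exists_direction hU.pos hU.lt (not_lt.1 fun h => hn ⟨h0, h⟩)
  refine ⟨fun ξ hξ => ?_, fun ξ hξ h0 hn g => ?_⟩
  · by_contra hcon
    rw [mem_union, not_or] at hcon
    obtain ⟨w, hw, -, hre⟩ := hdir ξ hcon.2 hcon.1
    have hpos : 0 < (ξ * w).re := lt_of_lt_of_le (mul_pos (norm_pos_iff.2 hcon.2) hs) hre
    exact notMem_opSpectrum (fun f hf => hU.eq_zero_of_eigenvector hE hw hpos hf)
      (fun g => ⟨_, hU.hasGenerator_rayLaplace hE hw hpos g⟩) hξ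
  · obtain ⟨w, hw, hw1, hre⟩ := hdir ξ h0 hn
    have hξ0 := norm_pos_iff.2 h0
    have hpos : 0 < (ξ * w).re := lt_of_lt_of_le (mul_pos hξ0 hs) hre
    have h1 := opResolvent_apply hξ (hU.hasGenerator_rayLaplace hE hw hpos g)
    rw [sub_sub_cancel] at h1
    rw [h1]
    refine (hU.norm_rayLaplace_le hw hpos g).trans ?_
    rw [hw1, one_mul, div_div, mul_comm (Real.sin _)]
    have := hU.bound_nonneg
    gcongr

end IsSectorialExtension

end

theorem mainTheorem1 {F : Type*} [NormedAddCommGroup F] [NormedSpace ℂ F] [CompleteSpace F]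
    (E : ℝ → F →L[ℂ] F) (hE : IsC0Semigroup E) :
    (HasAnalyticOrbits E ↔
      ∃ δ C : ℝ, 0 < δ ∧ δ < Real.pi / 2 ∧ SectorialBound (generator E) δ C) ∧
    (∀ δ C : ℝ, 0 < δ → δ < Real.pi / 2 → SectorialBound (generator E) δ C →
      (∀ (f : F) (t : ℝ), 0 < t → AnalyticAt ℝ (fun s : ℝ => E s f) t) ∧
      ∀ (τ₀ : ℝ) (f g : F), 0 < τ₀ → f = E τ₀ g →
        f ∈ domInfty (generator E) ∧
        ∀ t : ℝ, 0 ≤ t → t < τ₀ / (C * Real.exp 1) →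
          Tendsto (fun M : ℕ => ‖E t f - taylorSum (generator E) f M t‖) atTop (𝓝 0)) := by
  refine ⟨⟨fun h => ?_, fun ⟨δ, C, hδ, _, h⟩ => hE.hasAnalyticOrbits_of_sectorialBound hδ h⟩,
    fun δ C hδ _ h => ⟨fun f t ht => (hE.hasAnalyticOrbits_of_sectorialBound hδ h).analyticAt f ht,
      fun τ f g hτ hf => hf ▸ hE.mem_domInfty_and_tendsto hδ h hτ g⟩⟩
  obtain ⟨θ, K, U, hU⟩ := h.exists_isSectorialExtension
  exact ⟨θ / 4, _, by linarith [hU.pos], by linarith [hU.pos, hU.lt], hU.sectorialBound hE⟩
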